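/- Let $k$ be a field and let $\mathsf{D}^{\mathrm{perf}}(k[x]) = \mathsf{K}^{\mathrm{b}}(\mathrm{proj}\,k[x])$ be the tensor triangulated category of bounded complexes of finitely generated projective $k[x]$-modules up to homotopy, with $\otimes = \otimes_{k[x]}$. A module with a finite projective resolution is regarded as an object of it through such a resolution. Let $\mathrm{Thick}^{\sqrt{\otimes}}(\mathsf{D}^{\mathrm{perf}}(k[x]))$ be the lattice, ordered by inclusion, of radical thick tensor-ideals (thick subcategories $\mathsf{J}$ with $E \otimes F \in \mathsf{J}$ for all $E$ and all $F \in \mathsf{J}$, and such that $E^{\otimes n} \in \mathsf{J}$ implies $E \in \mathsf{J}$). Let $\mathrm{Thom}(\operatorname{Spec} k[x])$ be the lattice of Thomason subsets of $\operatorname{Spec} k[x]$, i.e. of unions of closed subsets with quasi-compact complement. Both lattices are coherent frames: frames in which every element is a join of compact elements and the compact elements are closed under finite meets (including the top element). The assignments $$\phi(\mathsf{J}) = \{\mathfrak{p} \in \operatorname{Spec} k[x] \mid k[x]/\mathfrak{p} \in \mathsf{J}\}, \qquad \psi(V) = \mathrm{thick}(k[x]/\mathfrak{p} \mid \mathfrak{p}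 \in V)$$ are well-defined maps $$\phi\colon \mathrm{Thick}^{\sqrt{\otimes}}(\mathsf{D}^{\mathrm{perf}}(k[x])) \to \mathrm{Thom}(\operatorname{Spec} k[x]), \qquad \psi\colon \mathrm{Thom}(\operatorname{Spec} k[x]) \to \mathrm{Thick}^{\sqrt{\otimes}}(\mathsf{D}^{\mathrm{perf}}(k[x])),$$ they are morphisms of coherent frames (they preserve arbitrary joins, finite meets and compact elements), and they are inverse to each other. Let $\operatorname{Spc} \mathsf{D}^{\mathrm{perf}}(k[x])$ be the Hochster dual of the space of points of the frame $\mathrm{Thick}^{\sqrt{\otimes}}(\mathsf{D}^{\mathrm{perf}}(k[x]))$; that is, the topology is generated by the closed subsets with quasi-compact complement of the space of points. A point $p$ (a frame map to $\{0,1\}$) is identified with the ideal $\bigvee p^{-1}(0)$. Then there is a homeomorphism $\operatorname{Spec} k[x] \to \operatorname{Spc} \mathsf{D}^{\mathrm{perf}}(k[x])$ given by $\mathfrak{p} \mapsto \mathsf{P}(\mathfrak{p})$, where $$\mathsf{P}(\mathfrak{p}) = \{E \in \mathsf{D}^{\mathrm{perf}}(k[x]) \mid H^*(E)_{\mathfrak{p}}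 = 0\}$$ is a prime thick tensor-ideal (it is proper, and $E \otimes F \in \mathsf{P}(\mathfrak{p})$ implies $E \in \mathsf{P}(\mathfrak{p})$ or $F \in \mathsf{P}(\mathfrak{p})$). -/

import Mathlib

open CategoryTheory CategoryTheory.Limits CategoryTheory.MonoidalCategory
  CategoryTheory.Pretriangulated
open scoped ZeroObject

universe u v w

noncomputable section

section HomotopyTensor

variable (R : Type u) [CommRing R]

/-- Cochain complexes of `R`-modules, indexed by `ℤ`. -/
abbrev ModComplex : Type (u + 1) := CochainComplex (ModuleCat.{u} R) ℤ

/-- The homotopy category of cochain complexes of `R`-modules. -/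
abbrev KMod : Type (u + 1) := HomotopyCategory (ModuleCat.{u} R) (ComplexShape.up ℤ)

/-- The quotient functor from complexes to the homotopy category. -/
abbrev KMod.Q : ModComplex R ⥤ KMod R :=
  HomotopyCategory.quotient (ModuleCat.{u} R) (ComplexShape.up ℤ)

variable {R}

lemma KMod.whiskerLeft_homotopic (X : ModComplex R) {Y Z : ModComplex R} {f g : Y ⟶ Z}
    (h : (KMod.Q R).map f = (KMod.Q R).map g) :
    (KMod.Q R).map (X ◁ f) = (KMod.Q R).map (X ◁ g) :=
  HomotopyCategory.eq_of_homotopy _ _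
    (HomologicalComplex.mapBifunctorMapHomotopy₂ (𝟙 X)
      (HomotopyCategory.homotopyOfEq _ _ h) (curriedTensor (ModuleCat.{u} R)) (ComplexShape.up ℤ))

lemma KMod.whiskerRight_homotopic {Y Z : ModComplex R} {f g : Y ⟶ Z}
    (h : (KMod.Q R).map f = (KMod.Q R).map g) (X : ModComplex R) :
    (KMod.Q R).map (f ▷ X) = (KMod.Q R).map (g ▷ X) :=
  HomotopyCategory.eq_of_homotopy _ _
    (HomologicalComplex.mapBifunctorMapHomotopy₁
      (HomotopyCategory.homotopyOfEq _ _ h) (𝟙 X) (curriedTensor (ModuleCat.{u} R))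
      (ComplexShape.up ℤ))

/-- The tensor product of complexes of `R`-modules (the total complex of the modules `X^p ⊗ Y^q`), on the
homotopy category. -/
instance KMod.monoidalStruct : MonoidalCategoryStruct (KMod R) where
  tensorObj X Y := (KMod.Q R).obj (X.as ⊗ Y.as)
  whiskerLeft X _ _ f := (KMod.Q R).map (X.as ◁ Quot.out f)
  whiskerRight f X := (KMod.Q R).map (Quot.out f ▷ X.as)
  tensorUnit := (KMod.Q R).obj (𝟙_ (ModComplex R))
  associator X Y Z := (KMod.Q R).mapIso (α_ X.as Y.as Z.as)
  leftUnitor X := (KMod.Q R).mapIso (λ_ X.as)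
  rightUnitor X := (KMod.Q R).mapIso (ρ_ X.as)

lemma KMod.whiskerLeft_map (X : ModComplex R) {Y Z : ModComplex R} (f : Y ⟶ Z) :
    (KMod.Q R).obj X ◁ (KMod.Q R).map f = (KMod.Q R).map (X ◁ f) :=
  KMod.whiskerLeft_homotopic X (HomotopyCategory.quotient_map_out _)

lemma KMod.map_whiskerRight (X : ModComplex R) {Y Z : ModComplex R} (f : Y ⟶ Z) :
    (KMod.Q R).map f ▷ (KMod.Q R).obj X = (KMod.Q R).map (f ▷ X) :=
  KMod.whiskerRight_homotopic (HomotopyCategory.quotient_map_out _) X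

lemma KMod.map_tensorHom {X Y Z W : ModComplex R} (f : X ⟶ Y) (g : Z ⟶ W) :
    (KMod.Q R).map f ⊗ₘ (KMod.Q R).map g = (KMod.Q R).map (f ⊗ₘ g) := by
  rw [MonoidalCategory.tensorHom_def, Functor.map_comp, ← KMod.map_whiskerRight,
    ← KMod.whiskerLeft_map]
  rfl

lemma KMod.tensor_obj (X Y : ModComplex R) :
    (KMod.Q R).obj X ⊗ (KMod.Q R).obj Y = (KMod.Q R).obj (X ⊗ Y) := rfl

lemma KMod.Q_surj {X Y : KMod R} (f : X ⟶ Y) :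
    ∃ g : X.as ⟶ Y.as, (KMod.Q R).map g = f := (KMod.Q R).map_surjective f

set_option maxHeartbeats 1000000 in
instance KMod.monoidal : MonoidalCategory (KMod R) where
  tensorHom_def _ _ := rfl
  id_tensorHom_id X Y := by
    refine (KMod.map_tensorHom (𝟙 X.as) (𝟙 Y.as)).trans ?_
    rw [id_tensorHom_id]; rfl
  tensorHom_comp_tensorHom f₁ f₂ g₁ g₂ := by
    obtain ⟨f₁, rfl⟩ := KMod.Q_surj f₁
    obtain ⟨f₂, rfl⟩ := KMod.Q_surj f₂
    obtain ⟨g₁, rfl⟩ := KMod.Q_surj g₁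
    obtain ⟨g₂, rfl⟩ := KMod.Q_surj g₂
    have h := congrArg (KMod.Q R).map (tensorHom_comp_tensorHom f₁ f₂ g₁ g₂)
    rw [Functor.map_comp, ← KMod.map_tensorHom, ← KMod.map_tensorHom, ← KMod.map_tensorHom,
      Functor.map_comp, Functor.map_comp] at h
    exact h
  whiskerLeft_id X Y := by
    refine (KMod.whiskerLeft_map X.as (𝟙 Y.as)).trans ?_
    rw [whiskerLeft_id]; rfl
  id_whiskerRight X Y := by
    refine (KMod.map_whiskerRight Y.as (𝟙 X.as)).trans ?_
    rw [id_whiskerRight]; rfl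
  associator_naturality {X₁ X₂ X₃ Y₁ Y₂ Y₃} f₁ f₂ f₃ := by
    obtain ⟨f₁, rfl⟩ := KMod.Q_surj f₁
    obtain ⟨f₂, rfl⟩ := KMod.Q_surj f₂
    obtain ⟨f₃, rfl⟩ := KMod.Q_surj f₃
    have h := congrArg (KMod.Q R).map (associator_naturality f₁ f₂ f₃)
    rw [Functor.map_comp, Functor.map_comp, ← KMod.map_tensorHom, ← KMod.map_tensorHom,
      ← KMod.map_tensorHom, ← KMod.map_tensorHom] at h
    exact h
  leftUnitor_naturality f := by
    obtain ⟨f, rfl⟩ := KMod.Q_surj f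
    have h := congrArg (KMod.Q R).map (leftUnitor_naturality f)
    rw [Functor.map_comp, Functor.map_comp, ← KMod.whiskerLeft_map] at h
    exact h
  rightUnitor_naturality f := by
    obtain ⟨f, rfl⟩ := KMod.Q_surj f
    have h := congrArg (KMod.Q R).map (rightUnitor_naturality f)
    rw [Functor.map_comp, Functor.map_comp, ← KMod.map_whiskerRight] at h
    exact h
  pentagon W X Y Z := by
    have h := congrArg (KMod.Q R).map (pentagon W.as X.as Y.as Z.as)
    have h₁ := KMod.map_whiskerRight Z.as (α_ W.as X.as Y.as).hom
    have h₂ := KMod.whiskerLeft_map W.as (α_ X.as Y.as Z.as).hom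
    rw [Functor.map_comp, Functor.map_comp, Functor.map_comp, ← h₁, ← h₂] at h
    exact h
  triangle X Y := by
    have h := congrArg (KMod.Q R).map (triangle X.as Y.as)
    have h₁ := KMod.map_whiskerRight Y.as (ρ_ X.as).hom
    have h₂ := KMod.whiskerLeft_map X.as (λ_ Y.as).hom
    rw [Functor.map_comp, ← h₁, ← h₂] at h
    exact h

end HomotopyTensor

section Perfect

variable (R : Type u) [CommRing R]

/-- A complex of `R`-modules is strictly perfect if it is bounded and consists of finitely
generated projective modules. -/
structure IsStrictlyPerfect (X : ModComplex R) : Prop where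
  bounded : ∃ a b : ℤ, ∀ i : ℤ, i < a ∨ b < i → IsZero (X.X i)
  finite : ∀ i : ℤ, Module.Finite R (X.X i)
  projective : ∀ i : ℤ, Module.Projective R (X.X i)

/-- The strictly perfect complexes, as a class of objects of the homotopy category. -/
def perfProp : ObjectProperty (KMod R) := fun X => IsStrictlyPerfect R X.as

variable {R}

lemma IsStrictlyPerfect.of_isZero {X : ModComplex R} (hX : IsZero X) :
    IsStrictlyPerfect R X := by
  have h : ∀ i : ℤ, IsZero (X.X i) := fun i =>
    Functor.map_isZero (HomologicalComplex.eval _ _ i) hX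
  have h' : ∀ i : ℤ, Subsingleton (X.X i) := fun i =>
    ModuleCat.subsingleton_of_isZero (h i)
  exact ⟨⟨0, 0, fun i _ => h i⟩, fun i => inferInstance, fun i => inferInstance⟩

lemma IsStrictlyPerfect.shift {X : ModComplex R} (h : IsStrictlyPerfect R X) (n : ℤ) :
    IsStrictlyPerfect R (X⟦n⟧) := by
  obtain ⟨a, b, hab⟩ := h.bounded
  refine ⟨⟨a - n, b - n, fun i hi => hab (i + n) (by omega)⟩, fun i => h.finite (i + n),
    fun i => h.projective (i + n)⟩

lemma IsStrictlyPerfect.mappingCone {X Y : ModComplex R} (hX : IsStrictlyPerfect R X)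
    (hY : IsStrictlyPerfect R Y) (f : X ⟶ Y) :
    IsStrictlyPerfect R (CochainComplex.mappingCone f) := by
  have e : ∀ i : ℤ, (CochainComplex.mappingCone f).X i ≅
      ModuleCat.of R (X.X (i + 1) × Y.X i) := fun i =>
    HomologicalComplex.homotopyCofiber.XIsoBiprod f i (i + 1) rfl ≪≫
      ModuleCat.biprodIsoProd _ _
  have := hX.finite
  have := hX.projective
  have := hY.finite
  have := hY.projective
  obtain ⟨a, b, hab⟩ := hX.bounded
  obtain ⟨c, d, hcd⟩ := hY.bounded
  refine ⟨⟨min (a - 1) c, max b d, fun i hi => ?_⟩,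
    fun i => Module.Finite.equiv (e i).symm.toLinearEquiv,
    fun i => Module.Projective.of_equiv (e i).symm.toLinearEquiv⟩
  have h1 := ModuleCat.subsingleton_of_isZero (hab (i + 1) (by omega))
  have h2 := ModuleCat.subsingleton_of_isZero (hcd i (by omega))
  exact (ModuleCat.isZero_of_subsingleton (ModuleCat.of R (X.X (i + 1) × Y.X i))).of_iso (e i)

lemma IsStrictlyPerfect.unit : IsStrictlyPerfect R (𝟙_ (ModComplex R)) := by
  have e : (𝟙_ (ModComplex R)).X 0 ≅ ModuleCat.of R R :=
    HomologicalComplex.singleObjXSelf (ComplexShape.up ℤ) (0 : ℤ) (ModuleCat.of R R)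
  have hz : ∀ i : ℤ, i ≠ 0 → IsZero ((𝟙_ (ModComplex R)).X i) := fun i hi =>
    HomologicalComplex.isZero_single_obj_X (ComplexShape.up ℤ) (0 : ℤ) (ModuleCat.of R R) i hi
  refine ⟨⟨0, 0, fun i hi => hz i (by omega)⟩, fun i => ?_, fun i => ?_⟩
  · by_cases hi : i = 0
    · subst hi
      exact Module.Finite.equiv e.symm.toLinearEquiv
    · have := ModuleCat.subsingleton_of_isZero (hz i hi)
      infer_instance
  · by_cases hi : i = 0
    · subst hi
      exact Module.Projective.of_equiv e.symm.toLinearEquiv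
    · have := ModuleCat.subsingleton_of_isZero (hz i hi)
      infer_instance

lemma IsStrictlyPerfect.tensor {X Y : ModComplex R} (hX : IsStrictlyPerfect R X)
    (hY : IsStrictlyPerfect R Y) : IsStrictlyPerfect R (X ⊗ Y) := by
  have := hX.finite
  have := hX.projective
  have := hY.finite
  have := hY.projective
  obtain ⟨a, b, hab⟩ := hX.bounded
  obtain ⟨c, d, hcd⟩ := hY.bounded
  have hz : ∀ i j : ℤ, (i < a ∨ b < i) ∨ (j < c ∨ d < j) →
      IsZero (((curriedTensor (ModuleCat.{u} R)).obj (X.X i)).obj (Y.X j)) := by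
    rintro i j (h | h)
    · have := ModuleCat.subsingleton_of_isZero (hab i h)
      exact ModuleCat.isZero_of_subsingleton (ModuleCat.of R (TensorProduct R (X.X i) (Y.X j)))
    · have := ModuleCat.subsingleton_of_isZero (hcd j h)
      exact ModuleCat.isZero_of_subsingleton (ModuleCat.of R (TensorProduct R (X.X i) (Y.X j)))
  refine ⟨⟨a + c, b + d, fun n hn => ?_⟩, fun n => ?_, fun n => ?_⟩
  · rw [IsZero.iff_id_eq_zero]
    refine HomologicalComplex.mapBifunctor.hom_ext fun i j hij => ?_
    exact (hz i j (by change i + j = n at hij; omega)).eq_of_src _ _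
  · let ι := fun (i j : ℤ) (h : i + j = n) =>
      HomologicalComplex.ιMapBifunctor X Y (curriedTensor (ModuleCat.{u} R))
        (ComplexShape.up ℤ) i j n h
    let N : Submodule R ((X ⊗ Y).X n) :=
      ⨆ i ∈ Finset.Icc a b, LinearMap.range (ι i (n - i) (by omega)).hom
    have hfin : ∀ i j : ℤ, Module.Finite R
        (((curriedTensor (ModuleCat.{u} R)).obj (X.X i)).obj (Y.X j)) := fun i j =>
      inferInstanceAs (Module.Finite R (TensorProduct R (X.X i) (Y.X j)))
    have hN : N.FG := Submodule.fg_biSup _ _ fun i _ => by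
      have := hfin i (n - i)
      exact Submodule.fg_range _
    have hq : ModuleCat.ofHom N.mkQ = 0 := by
      refine HomologicalComplex.mapBifunctor.hom_ext fun i j hij => ?_
      by_cases hi : i ∈ Finset.Icc a b
      · obtain rfl : j = n - i := by change i + j = n at hij; omega
        ext x
        have hx : (ι i (n - i) hij).hom x ∈ N :=
          Submodule.mem_iSup_of_mem i (Submodule.mem_iSup_of_mem hi ⟨x, rfl⟩)
        exact (Submodule.Quotient.mk_eq_zero N).2 hx
      · exact (hz i j (by simp only [Finset.mem_Icc] at hi; omega)).eq_of_src _ _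
    have hN' : N = ⊤ := by
      rw [← N.ker_mkQ, LinearMap.ker_eq_top]
      exact congrArg ModuleCat.Hom.hom hq
    exact ⟨hN' ▸ hN⟩
  · have hp : ∀ i j : ℤ, Projective
        (((curriedTensor (ModuleCat.{u} R)).obj (X.X i)).obj (Y.X j)) := fun i j =>
      (IsProjective.iff_projective (TensorProduct R (X.X i) (Y.X j))).1 inferInstance
    refine (IsProjective.iff_projective ((X ⊗ Y).X n)).2 ⟨fun {E Z} f e he => ?_⟩
    refine ⟨HomologicalComplex.mapBifunctorDesc fun i j h => Projective.factorThru
      (HomologicalComplex.ιMapBifunctor X Y (curriedTensor (ModuleCat.{u} R))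
        (ComplexShape.up ℤ) i j n h ≫ f) e, ?_⟩
    refine HomologicalComplex.mapBifunctor.hom_ext fun i j hij => ?_
    rw [HomologicalComplex.ι_mapBifunctorDesc_assoc, Projective.factorThru_comp]

instance : (perfProp R).IsStableUnderShift ℤ where
  isStableUnderShiftBy n := ⟨fun X hX => by
    rw [ObjectProperty.prop_shift_iff]
    have h := HomotopyCategory.shift_quotient_obj X.as n
    change perfProp R (((KMod.Q R).obj X.as)⟦n⟧)
    rw [h]
    exact IsStrictlyPerfect.shift (X := X.as) hX n⟩

instance : (perfProp R).IsTriangulated where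
  exists_zero := ⟨(KMod.Q R).obj (HomologicalComplex.zero),
    Functor.map_isZero _ HomologicalComplex.isZero_zero,
    IsStrictlyPerfect.of_isZero HomologicalComplex.isZero_zero⟩
  toIsTriangulatedClosed₂ :=
    have : (perfProp R).IsTriangulatedClosed₃ := ⟨fun T hT h₁ h₂ => by
      obtain ⟨f, hf⟩ := KMod.Q_surj T.mor₁
      refine ⟨(KMod.Q R).obj (CochainComplex.mappingCone f),
        IsStrictlyPerfect.mappingCone h₁ h₂ f, ⟨?_⟩⟩
      exact Triangle.π₃.mapIso (isoTriangleOfIso₁₂ T (CochainComplex.mappingCone.triangleh f) hT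
        (HomotopyCategory.mappingCone_triangleh_distinguished f) (Iso.refl _) (Iso.refl _)
        ((Category.comp_id _).trans (hf.symm.trans (Category.id_comp _).symm)))⟩
    ObjectProperty.IsTriangulatedClosed₂.of_isTriangulatedClosed₃

instance : (perfProp R).IsMonoidal where
  prop_unit := IsStrictlyPerfect.unit
  prop_tensor _ _ h₁ h₂ := IsStrictlyPerfect.tensor h₁ h₂

variable (R)

/-- The category `D^perf(R) = K^b(proj R)`: bounded complexes of finitely generated projective
`R`-modules and homotopy classes of chain maps. It is a full triangulated and monoidal
subcategory of the homotopy category of complexes of `R`-modules. -/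
abbrev DPerf : Type (u + 1) := (perfProp R).FullSubcategory

variable {R}

/-- The underlying complex of a perfect complex. -/
abbrev DPerf.cpx (E : DPerf R) : ModComplex R := E.obj.as

/-- The perfect complex `E` represents the `R`-module `M`, i.e. it is isomorphic to `M` (placed in
degree `0`) in the derived category of `R`: as `E` is a bounded complex of projectives, this means
that there is a quasi-isomorphism from `E` to `M[0]`. -/
def DPerf.Represents (E : DPerf R) (M : ModuleCat.{u} R) : Prop :=
  ∃ f : E.cpx ⟶ (HomologicalComplex.single (ModuleCat.{u} R) (ComplexShape.up ℤ) 0).obj M,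
    QuasiIso f

/-- The perfect complexes that represent the module `R ⧸ 𝔭`. -/
def residueObjects (𝔭 : PrimeSpectrum R) : ObjectProperty (DPerf R) :=
  fun E => E.Represents (ModuleCat.of R (R ⧸ 𝔭.asIdeal))

/-- `P(𝔭)`: the perfect complexes `E` with `H^*(E)_𝔭 = 0`. -/
def primeOf (𝔭 : PrimeSpectrum R) : ObjectProperty (DPerf R) :=
  fun E => ∀ i : ℤ, Subsingleton (LocalizedModule 𝔭.asIdeal.primeCompl (E.cpx.homology i))

end Perfect

section TensorTriangular

variable {K : Type v} [Category.{w} K] [HasZeroObject K] [Preadditive K] [HasShift K ℤ]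
  [∀ n : ℤ, (shiftFunctor K n).Additive] [Pretriangulated K]

/-- A thick subcategory: a full triangulated subcategory that is closed under direct summands. -/
structure IsThick (J : ObjectProperty K) : Prop where
  triangulated : J.IsTriangulated
  retracts : J.IsStableUnderRetracts

/-- `thick(A)`, the smallest thick subcategory containing the objects in `A`. -/
def thickClosure (A : ObjectProperty K) : ObjectProperty K :=
  fun X => ∀ J : ObjectProperty K, IsThick J → A ≤ J → J X

variable [MonoidalCategory K]

/-- A thick tensor-ideal. -/
structure IsThickTensorIdeal (J : ObjectProperty K) : Prop extends IsThick J where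
  tensor : ∀ X Y : K, J Y → J (X ⊗ Y)

/-- A prime thick tensor-ideal. -/
structure IsPrimeTensorIdeal (J : ObjectProperty K) : Prop extends IsThickTensorIdeal J where
  proper : J ≠ ⊤
  mem_or_mem : ∀ X Y : K, J (X ⊗ Y) → J X ∨ J Y

/-- The tensor power `X^{⊗ n}`. -/
def tensorPower (X : K) : ℕ → K
  | 0 => 𝟙_ K
  | n + 1 => tensorPower X n ⊗ X

variable (K) in
/-- The radical thick tensor-ideals of `K`. -/
structure RadicalTensorIdeal where
  /-- the class of objects of the ideal -/
  mem : ObjectProperty K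
  isThickTensorIdeal : IsThickTensorIdeal mem
  radical : ∀ (X : K) (n : ℕ), mem (tensorPower X n) → mem X

namespace RadicalTensorIdeal

lemma mem_injective : Function.Injective (mem : RadicalTensorIdeal K → ObjectProperty K) := by
  rintro ⟨J, _, _⟩ ⟨J', _, _⟩ h
  cases h
  rfl

/-- Radical thick tensor-ideals are ordered by inclusion. -/
instance : PartialOrder (RadicalTensorIdeal K) := PartialOrder.lift mem mem_injective

/-- The intersection of a set of radical thick tensor-ideals. -/
instance : InfSet (RadicalTensorIdeal K) where
  sInf S :=
    { mem := fun X => ∀ J ∈ S, J.mem X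
      isThickTensorIdeal :=
        { triangulated :=
            { exists_zero := ⟨0, isZero_zero K, fun J _ => by
                have := J.isThickTensorIdeal.triangulated
                have := J.isThickTensorIdeal.retracts
                exact ObjectProperty.prop_zero _⟩
              isStableUnderShiftBy := fun n => ⟨fun X hX J hJ => by
                have := J.isThickTensorIdeal.triangulated
                exact J.mem.le_shift n X (hX J hJ)⟩
              ext₂' := fun T hT h₁ h₃ => ObjectProperty.le_isoClosure _ _ fun J hJ => by
                have := J.isThickTensorIdeal.triangulated
                have := J.isThickTensorIdeal.retracts
                exact J.mem.ext_of_isTriangulatedClosed₂ T hT (h₁ J hJ) (h₃ J hJ) }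
          retracts := ⟨fun r hY J hJ => by
            have := J.isThickTensorIdeal.retracts
            exact J.mem.prop_of_retract r (hY J hJ)⟩
          tensor := fun X Y hY J hJ => J.isThickTensorIdeal.tensor X Y (hY J hJ) }
      radical := fun X n h J hJ => J.radical X n (h J hJ) }

/-- The complete lattice of radical thick tensor-ideals. -/
instance : CompleteLattice (RadicalTensorIdeal K) :=
  completeLatticeOfInf _ fun _ =>
    ⟨fun J hJ _ hX => hX J hJ, fun _ hI X hX _ hJ => hI hJ X hX⟩

end RadicalTensorIdeal

end TensorTriangular

section Coherent

/-- A coherent frame: a complete lattice that is a frame, is algebraic, and whose finitely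
presented (compact) elements are closed under finite meets. -/
structure IsCoherentFrame (F : Type v) [CompleteLattice F] : Prop where
  inf_sSup_eq : ∀ (f : F) (S : Set F), f ⊓ sSup S = ⨆ s ∈ S, f ⊓ s
  isCompactlyGenerated : IsCompactlyGenerated F
  isCompactElement_top : IsCompactElement (⊤ : F)
  isCompactElement_inf : ∀ a b : F, IsCompactElement a → IsCompactElement b →
    IsCompactElement (a ⊓ b)

/-- A morphism of coherent frames: a map that preserves arbitrary joins, finite meets, and
finitely presented (compact) elements. -/
structure IsCoherentFrameHom {F : Type v} {G : Type w} [CompleteLattice F] [CompleteLattice G]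
    (f : F → G) : Prop where
  map_sSup : ∀ S : Set F, f (sSup S) = sSup (f '' S)
  map_top : f ⊤ = ⊤
  map_inf : ∀ a b : F, f (a ⊓ b) = f a ⊓ f b
  map_isCompactElement : ∀ a : F, IsCompactElement a → IsCompactElement (f a)

variable (X : Type v) [TopologicalSpace X]

/-- The subsets of `X` that are closed and have a quasi-compact complement. -/
def basicThomason : Set (Set X) := {V | IsClosed V ∧ IsCompact Vᶜ}

/-- The Thomason subsets of `X`: unions of closed subsets with quasi-compact complement. -/
structure Thom where
  /-- the underlying subset -/
  carrier : Set X
  isThomason : ∃ S ⊆ basicThomason X, carrier = ⋃₀ S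

namespace Thom

variable {X}

lemma carrier_injective : Function.Injective (carrier : Thom X → Set X) := by
  rintro ⟨V, _⟩ ⟨W, _⟩ h
  cases h
  rfl

/-- Thomason subsets are ordered by inclusion. -/
instance : PartialOrder (Thom X) := PartialOrder.lift carrier carrier_injective

/-- The union of a set of Thomason subsets. -/
instance : SupSet (Thom X) where
  sSup A :=
    { carrier := ⋃₀ (carrier '' A)
      isThomason := by
        refine ⟨{W | W ∈ basicThomason X ∧ W ⊆ ⋃₀ (carrier '' A)}, fun W hW => hW.1, ?_⟩
        refine subset_antisymm (fun x => ?_) (Set.sUnion_subset fun W hW => hW.2)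
        rintro ⟨_, ⟨V, hV, rfl⟩, hx⟩
        obtain ⟨S, hS, hVS⟩ := V.isThomason
        rw [hVS] at hx
        obtain ⟨W, hW, hxW⟩ := hx
        exact ⟨W, ⟨hS hW, fun y hy => ⟨V.carrier, ⟨V, hV, rfl⟩, hVS ▸ ⟨W, hW, hy⟩⟩⟩, hxW⟩ }

/-- The complete lattice of Thomason subsets; joins are unions. -/
instance : CompleteLattice (Thom X) :=
  completeLatticeOfSup _ fun A =>
    ⟨fun V hV => Set.subset_sUnion_of_mem ⟨V, hV, rfl⟩, fun W hW => by
      refine Set.sUnion_subset ?_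
      rintro _ ⟨V, hV, rfl⟩
      exact hW hV⟩

end Thom

/-- The Hochster dual `X^∨` of a space `X`: the same set of points, with the topology generated by
the closed subsets of `X` with quasi-compact complement. -/
structure HochsterDual where
  /-- the underlying point of `X` -/
  point : X

instance : TopologicalSpace (HochsterDual X) :=
  TopologicalSpace.generateFrom {U | ∃ V ∈ basicThomason X, HochsterDual.point ⁻¹' V = U}

end Coherent

section Spectrum

variable (K : Type v) [Category.{w} K] [HasZeroObject K] [Preadditive K] [HasShift K ℤ]
  [∀ n : ℤ, (shiftFunctor K n).Additive] [Pretriangulated K] [MonoidalCategory K]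

/-- The spectrum of `K`: the Hochster dual of the space of points of the frame of radical thick
tensor-ideals of `K`. -/
abbrev Spc := HochsterDual (Locale.PT (RadicalTensorIdeal K))

variable {K}

/-- The ideal that corresponds to a point `p` of the spectrum, that is the prime element
`⋁ p⁻¹(0)` of the frame of radical thick tensor-ideals. -/
def Spc.ideal (p : Spc K) : RadicalTensorIdeal K := sSup {J | ¬ p.point J}

end Spectrum

end

/-! ### Coherent frames under order isomorphisms. -/

section CoherentFrameTransport

variable {F : Type v} {G : Type w} [CompleteLattice F] [CompleteLattice G]

/-! Only two properties of `k[x]` matter: it is a domain and a principal ideal ring. Let `R` be such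
a ring. The core is an order isomorphism `supportIso` between radical thick tensor-ideals of perfect
complexes and Thomason subsets of `Spec R`; coherence, the frame morphisms and the homeomorphism are
then properties of the lattice of Thomason subsets of a noetherian sober space.

Cocycles are direct summands of a perfect complex over `R`, so a scalar that annihilates all
cohomology is null-homotopic. Hence `E` lies in `P(𝔭)` iff some `s ∉ 𝔭` acts as zero on `E`
(`primeOf_iff`), and thickness and the ideal property become formal. Primality
(`primeOf_mem_or_mem`) replaces the Künneth formula by functionals with values in the residue field,
which multiply on tensor products.

Conversely, Smith normal form writes the identity of a perfect complex as a sum of idempotents whose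
images are shifts of `R` or cones of nonzero scalars on them (`id_mem_closure_elementaryEnd`). The
octahedral axiom builds the cone of `a` from cones of its prime factors (`IsCone.prop_mul`), and the
cone of a divisor of `c` lies in the thick subcategory generated by the cone of `c`
(`IsCone.prop_of_dvd`). So a thick subcategory contains `E` as soon as each prime in the support of
`E` supports one of its objects (`IsThick.prop_of_forall_primeOf`). Such a subcategory is determined
by its support, and every specialization-closed set occurs as a support.

On the topological side, each point of the frame comes from a unique point of `Spec R`
(`exists_thomPoint_eq`), and quasi-compact opens of the space of points correspond to closed subsets
of `Spec R` (`isCompact_setOf_apply_iff`), so the Hochster dual recovers the Zariski topology. -/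

lemma isCompactElement_orderIso (e : F ≃o G) {a : F} (ha : IsCompactElement a) :
    IsCompactElement (e a) := by
  rw [CompleteLattice.isCompactElement_iff_exists_le_sSup_of_le_sSup] at ha ⊢
  intro s hs
  have h : a ≤ sSup (e.symm '' s) := by
    rw [← map_sSup]
    exact (e.le_symm_apply).2 hs
  classical
  obtain ⟨t, ht, hat⟩ := ha _ h
  refine ⟨t.image e, fun y hy => ?_, ?_⟩
  · obtain ⟨x, hx, rfl⟩ := Finset.mem_image.1 (Finset.mem_coe.1 hy)
    obtain ⟨y, hy, rfl⟩ := ht hx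
    rwa [e.apply_symm_apply]
  · have := e.monotone hat
    rwa [map_finset_sup, Function.comp_id, ← Function.id_comp e, ← Finset.sup_image] at this

lemma IsCoherentFrame.of_orderIso (e : F ≃o G) (hF : IsCoherentFrame F) : IsCoherentFrame G where
  inf_sSup_eq g S := by
    apply e.symm.injective
    simp only [map_inf, map_sSup, map_iSup]
    rw [hF.inf_sSup_eq, iSup_image]
  isCompactlyGenerated := ⟨fun g => by
    obtain ⟨s, hs, hg⟩ := hF.isCompactlyGenerated.exists_sSup_eq (e.symm g)
    refine ⟨e '' s, ?_, by rw [← map_sSup, hg, e.apply_symm_apply]⟩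
    rintro _ ⟨x, hx, rfl⟩
    exact isCompactElement_orderIso e (hs x hx)⟩
  isCompactElement_top := by
    rw [← map_top e]
    exact isCompactElement_orderIso e hF.isCompactElement_top
  isCompactElement_inf a b ha hb := by
    rw [← e.apply_symm_apply a, ← e.apply_symm_apply b, ← map_inf]
    exact isCompactElement_orderIso e (hF.isCompactElement_inf _ _
      (isCompactElement_orderIso e.symm ha) (isCompactElement_orderIso e.symm hb))

lemma OrderIso.isCoherentFrameHom (e : F ≃o G) : IsCoherentFrameHom e where
  map_sSup S := by rw [e.map_sSup, sSup_image]
  map_top := map_top e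
  map_inf := map_inf e
  map_isCompactElement _ := isCompactElement_orderIso e

end CoherentFrameTransport

/-! ### Thomason subsets of a noetherian space, points of their frame, and the Hochster dual. -/

section Noetherian

variable {X : Type v} [TopologicalSpace X]

namespace Thom

lemma le_iff {V W : Thom X} : V ≤ W ↔ V.carrier ⊆ W.carrier := Iff.rfl

lemma carrier_sSup (S : Set (Thom X)) : (sSup S).carrier = ⋃₀ (carrier '' S) := rfl

lemma mem_carrier_sSup {S : Set (Thom X)} {x : X} :
    x ∈ (sSup S).carrier ↔ ∃ V ∈ S, x ∈ V.carrier := by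
  simp [carrier_sSup]

lemma closure_subset (V : Thom X) {x : X} (hx : x ∈ V.carrier) : closure {x} ⊆ V.carrier := by
  obtain ⟨S, hS, hV⟩ := V.isThomason
  rw [hV] at hx ⊢
  obtain ⟨W, hW, hxW⟩ := hx
  exact (closure_minimal (Set.singleton_subset_iff.2 hxW) (hS hW).1).trans
    (Set.subset_sUnion_of_mem hW)

variable [TopologicalSpace.NoetherianSpace X]

/-- A specialization-closed subset of a noetherian space, as a Thomason subset. -/
def ofStable (C : Set X) (hC : ∀ x ∈ C, closure {x} ⊆ C) : Thom X where
  carrier := C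
  isThomason := by
    refine ⟨(fun x => closure {x}) '' C, ?_, ?_⟩
    · rintro _ ⟨x, -, rfl⟩
      exact ⟨isClosed_closure, TopologicalSpace.NoetherianSpace.isCompact _⟩
    · refine subset_antisymm (fun x hx => ⟨_, ⟨x, hx, rfl⟩, subset_closure rfl⟩) ?_
      refine Set.sUnion_subset ?_
      rintro _ ⟨x, hx, rfl⟩
      exact hC x hx

/-- A closed subset of a noetherian space, as a Thomason subset. -/
def ofClosed (C : Set X) (hC : IsClosed C) : Thom X :=
  ofStable C fun _ hx => closure_minimal (Set.singleton_subset_iff.2 hx) hC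

lemma sSup_ofClosed_closure (V : Thom X) :
    sSup ((fun x => ofClosed (closure {x}) isClosed_closure) '' V.carrier) = V := by
  refine le_antisymm (sSup_le ?_) fun x hx => ?_
  · rintro _ ⟨x, hx, rfl⟩
    exact V.closure_subset hx
  · exact mem_carrier_sSup.2 ⟨_, ⟨x, hx, rfl⟩, subset_closure rfl⟩

lemma carrier_inf (V W : Thom X) : (V ⊓ W).carrier = V.carrier ∩ W.carrier := by
  refine subset_antisymm (Set.subset_inter (le_iff.1 inf_le_left) (le_iff.1 inf_le_right)) ?_
  have h : ofStable (V.carrier ∩ W.carrier) (fun x hx => Set.subset_inter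
      (V.closure_subset hx.1) (W.closure_subset hx.2)) ≤ V ⊓ W :=
    le_inf Set.inter_subset_left Set.inter_subset_right
  exact h

lemma carrier_top : (⊤ : Thom X).carrier = Set.univ :=
  Set.univ_subset_iff.1 (le_iff.1 (le_top : ofClosed Set.univ isClosed_univ ≤ ⊤))

end Thom

variable [TopologicalSpace.NoetherianSpace X]

variable {L : Type w} [CompleteLattice L] (e : L ≃o Thom X)

/-- The point of the frame of Thomason subsets given by a point of the space. -/
def thomPoint (x : X) : Locale.PT L where
  toFun u := x ∈ (e u).carrier
  map_inf' a b := by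
    simp only [map_inf, Thom.carrier_inf]
    rfl
  map_top' := by
    simp only [map_top, Thom.carrier_top]
    exact propext (iff_of_true trivial trivial)
  map_sSup' S := by
    rw [e.map_sSup, ← sSup_image, sSup_Prop_eq]
    simp only [Thom.mem_carrier_sSup, Set.mem_image, exists_exists_and_eq_and]

lemma thomPoint_apply (x : X) (u : L) : thomPoint e x u = (x ∈ (e u).carrier) := rfl

lemma thomPoint_injective [T0Space X] : Function.Injective (thomPoint e) := by
  intro x y hxy
  have h : ∀ V : Thom X, x ∈ V.carrier ↔ y ∈ V.carrier := fun V => by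
    have := DFunLike.congr_fun hxy (e.symm V)
    simp only [thomPoint_apply, e.apply_symm_apply] at this
    exact this.to_iff
  refine Inseparable.eq (Specializes.antisymm ?_ ?_)
  · rw [specializes_iff_mem_closure]
    exact (h (.ofClosed (closure {x}) isClosed_closure)).1 (subset_closure rfl)
  · rw [specializes_iff_mem_closure]
    exact (h (.ofClosed (closure {y}) isClosed_closure)).2 (subset_closure rfl)

/-- Every Thomason subset is a union of point closures, so `p` is true on some `closure {x}`;
noetherianity allows a minimal one. If `p u` holds, then `p` is true on `u ∩ closure {x}`, hence on
some `closure {y}` inside it. Minimality gives `closure {y} = closure {x}`, and so `x` lies in `u`.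
-/
lemma exists_thomPoint_eq (p : Locale.PT L) : ∃ x, thomPoint e x = p := by
  let cl : X → Thom X := fun x => Thom.ofClosed (closure {x}) isClosed_closure
  have hp : ∀ V : Thom X, p (e.symm V) ↔ ∃ x ∈ V.carrier, p (e.symm (cl x)) := by
    intro V
    conv_lhs => rw [← V.sSup_ofClosed_closure]
    rw [map_sSup, map_sSup, sSup_Prop_eq]
    simp only [Set.mem_image, exists_exists_and_eq_and]
    rfl
  have hne : ∃ x, p (e.symm (cl x)) := by
    obtain ⟨x, -, hx⟩ := (hp ⊤).1 (by simp)
    exact ⟨x, hx⟩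
  let clo : X → TopologicalSpace.Closeds X := fun x => ⟨closure {x}, isClosed_closure⟩
  obtain ⟨x, hx, hmin⟩ := (InvImage.wf clo
    (wellFounded_lt (α := TopologicalSpace.Closeds X))).has_min
      {x | p (e.symm (cl x))} hne
  refine ⟨x, ?_⟩
  ext u
  rw [thomPoint_apply]
  constructor
  · intro h
    have hle : e.symm (cl x) ≤ u := e.symm_apply_le.2 ((e u).closure_subset h)
    exact (OrderHomClass.mono p hle : p _ ≤ p u) hx
  · intro h
    have h2 : p (e.symm (e u ⊓ cl x)) := by
      rw [map_inf, map_inf, e.symm_apply_apply]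
      exact ⟨h, hx⟩
    obtain ⟨y, hy, hpy⟩ := (hp _).1 h2
    rw [Thom.carrier_inf] at hy
    have hyx : closure {y} ⊆ closure {x} :=
      closure_minimal (Set.singleton_subset_iff.2 hy.2) isClosed_closure
    have hxy : closure {x} ⊆ closure {y} := by
      by_contra hc
      exact hmin y hpy (lt_of_le_not_ge (show clo y ≤ clo x from hyx) hc)
    exact (e u).closure_subset hy.1 (hxy (subset_closure rfl))

variable [QuasiSober X]

/-- A closed set is a finite union of irreducible closed sets, and quasi-sobriety gives each a
generic point. -/
lemma IsClosed.exists_finset_closure {C : Set X} (hC : IsClosed C) :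
    ∃ F : Finset X, C = ⋃ x ∈ F, closure {x} := by
  classical
  obtain ⟨S, hS, hcl, hirr, rfl⟩ :=
    TopologicalSpace.NoetherianSpace.exists_finite_set_isClosed_irreducible hC
  choose g hg using fun t : S => QuasiSober.sober (hirr t t.2) (hcl t t.2)
  have := hS.fintype
  refine ⟨Finset.univ.image g, ?_⟩
  rw [Finset.set_biUnion_finset_image, Set.sUnion_eq_iUnion]
  simp only [Finset.mem_univ, Set.iUnion_true]
  exact Set.iUnion_congr fun t => (hg t).symm

namespace Thom

lemma isCompactElement_of_isClosed {V : Thom X} (hV : IsClosed V.carrier) :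
    IsCompactElement V := by
  classical
  rw [CompleteLattice.isCompactElement_iff_exists_le_sSup_of_le_sSup]
  intro S hS
  obtain ⟨F, hF⟩ := hV.exists_finset_closure
  have h : ∀ x ∈ F, ∃ W ∈ S, x ∈ W.carrier := fun x hx => by
    rw [← mem_carrier_sSup]
    refine hS (hF ▸ ?_)
    exact Set.mem_biUnion hx (subset_closure rfl)
  choose! W hWS hW using h
  refine ⟨F.image W, fun y hy => ?_, ?_⟩
  · obtain ⟨x, hx, rfl⟩ := Finset.mem_image.1 (Finset.mem_coe.1 hy)
    exact hWS x hx
  · rw [le_iff, hF]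
    refine Set.iUnion₂_subset fun x hx => (closure_subset _ (hW x hx)).trans ?_
    exact le_iff.1 (Finset.le_sup (f := id) (Finset.mem_image_of_mem W hx))

/-- `V` is the join of the closures of its points; if it is compact, finitely many of them suffice,
and a finite union of closed sets is closed. -/
lemma isCompactElement_iff {V : Thom X} : IsCompactElement V ↔ IsClosed V.carrier := by
  refine ⟨fun h => ?_, isCompactElement_of_isClosed⟩
  rw [CompleteLattice.isCompactElement_iff_exists_le_sSup_of_le_sSup] at h
  obtain ⟨t, ht, hVt⟩ := h _ V.sSup_ofClosed_closure.ge
  have hV : V = sSup (t : Set (Thom X)) := by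
    refine le_antisymm (hVt.trans (by rw [Finset.sup_id_eq_sSup])) ?_
    exact (sSup_le_sSup ht).trans V.sSup_ofClosed_closure.le
  rw [hV, carrier_sSup, Set.sUnion_image]
  refine t.finite_toSet.isClosed_biUnion fun W hW => ?_
  obtain ⟨x, -, rfl⟩ := ht hW
  exact isClosed_closure

lemma isCoherentFrame : IsCoherentFrame (Thom X) where
  inf_sSup_eq V S := by
    apply carrier_injective
    ext x
    rw [← sSup_image]
    simp only [carrier_inf, Set.mem_inter_iff, mem_carrier_sSup, Set.mem_image,
      exists_exists_and_eq_and]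
    constructor
    · rintro ⟨hV, W, hW, hx⟩
      exact ⟨W, hW, hV, hx⟩
    · rintro ⟨W, hW, hV, hx⟩
      exact ⟨hV, W, hW, hx⟩
  isCompactlyGenerated := ⟨fun V => ⟨_, by
    rintro _ ⟨x, -, rfl⟩
    exact isCompactElement_of_isClosed isClosed_closure, V.sSup_ofClosed_closure⟩⟩
  isCompactElement_top := by
    rw [isCompactElement_iff, carrier_top]
    exact isClosed_univ
  isCompactElement_inf V W hV hW := by
    rw [isCompactElement_iff] at hV hW ⊢
    rw [carrier_inf]
    exact hV.inter hW

end Thom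

/-- This is what makes the Hochster dual return the original topology: complements of quasi-compact
opens of the space of points become the open subsets of `X`. -/
lemma isCompact_setOf_apply_iff (u : L) :
    IsCompact {p : Locale.PT L | p u} ↔ IsClosed (e u).carrier := by
  constructor
  · intro h
    let U : X → Set (Locale.PT L) := fun x =>
      {p | p (e.symm (Thom.ofClosed (closure {x}) isClosed_closure))}
    have hcov : {p : Locale.PT L | p u} ⊆ ⋃ x ∈ (e u).carrier, U x := by
      intro p hp
      obtain ⟨x, rfl⟩ := exists_thomPoint_eq e p
      refine Set.mem_biUnion (show x ∈ (e u).carrier from hp) ?_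
      change x ∈ (e (e.symm _)).carrier
      rw [e.apply_symm_apply]
      exact subset_closure rfl
    obtain ⟨b, hb, hfin, hcov⟩ := h.elim_finite_subcover_image (fun x _ => ⟨_, rfl⟩) hcov
    have : (e u).carrier = ⋃ x ∈ b, closure {x} := by
      refine subset_antisymm (fun y hy => ?_)
        (Set.iUnion₂_subset fun x hx => (e u).closure_subset (hb hx))
      have := hcov (show thomPoint e y ∈ {p : Locale.PT L | p u} from hy)
      obtain ⟨x, hx, hyx⟩ := Set.mem_iUnion₂.1 this
      change y ∈ (e (e.symm _)).carrier at hyx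
      rw [e.apply_symm_apply] at hyx
      exact Set.mem_biUnion hx hyx
    rw [this]
    exact hfin.isClosed_biUnion fun _ _ => isClosed_closure
  · intro h
    obtain ⟨F, hF⟩ := h.exists_finset_closure
    have hmem : ∀ y, y ∈ (e u).carrier ↔ ∃ x ∈ F, y ∈ closure {x} := fun y => by
      rw [hF]; simp
    refine isCompact_of_finite_subcover fun {ι} U hU hcov => ?_
    classical
    have hx : ∀ x ∈ F, ∃ i, thomPoint e x ∈ U i := fun x hx => Set.mem_iUnion.1
      (hcov (show x ∈ (e u).carrier from (hmem x).2 ⟨x, hx, subset_closure rfl⟩))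
    have : ∀ i, ∃ v : L, {p : Locale.PT L | p v} = U i := hU
    choose v hv using this
    choose i hi using fun x : F => hx x x.2
    refine ⟨Finset.univ.image i, fun p hp => ?_⟩
    obtain ⟨y, rfl⟩ := exists_thomPoint_eq e p
    obtain ⟨x, hxF, hyx⟩ := (hmem y).1 hp
    refine Set.mem_biUnion (Finset.mem_image_of_mem i (Finset.mem_univ ⟨x, hxF⟩)) ?_
    have := hi ⟨x, hxF⟩
    rw [← hv] at this ⊢
    -- An open set of points comes from a Thomason subset, so with the point of `x` it contains
    -- those of all specializations of `x`; finitely many generic points control the cover.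
    exact (e _).closure_subset this hyx

/-- A noetherian sober space is the Hochster dual of the space of points of its frame of Thomason
subsets. -/
noncomputable def homeoHochsterDual [T0Space X] : X ≃ₜ HochsterDual (Locale.PT L) := by
  refine Equiv.toHomeomorphOfContinuousOpen
    (Equiv.ofBijective (fun x => ⟨thomPoint e x⟩) ⟨fun x y h => ?_, fun p => ?_⟩) ?_ ?_
  · exact thomPoint_injective e (congrArg HochsterDual.point h)
  · obtain ⟨x, hx⟩ := exists_thomPoint_eq e p.point
    exact ⟨x, by cases p; cases hx; rfl⟩
  · refine continuous_generateFrom_iff.2 ?_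
    rintro _ ⟨V, ⟨hV, hc⟩, rfl⟩
    -- The open sets of the space of points are by definition the sets `{p | p u}`.
    obtain ⟨u, hu⟩ := hV.isOpen_compl
    change {p : Locale.PT L | p u} = Vᶜ at hu
    rw [← hu, isCompact_setOf_apply_iff e] at hc
    rw [← isClosed_compl_iff]
    convert hc using 1
    ext x
    exact (Set.ext_iff.1 hu (thomPoint e x)).symm
  · intro U hU
    let u := e.symm (Thom.ofClosed Uᶜ hU.isClosed_compl)
    have hu : (e u).carrier = Uᶜ := by simp only [u, e.apply_symm_apply]; rfl
    have hc : IsCompact {p : Locale.PT L | p u} :=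
      (isCompact_setOf_apply_iff e u).2 (hu ▸ hU.isClosed_compl)
    refine TopologicalSpace.isOpen_generateFrom_of_mem
      ⟨{p : Locale.PT L | p u}ᶜ, ⟨(show IsOpen {p : Locale.PT L | p u} from
        ⟨u, rfl⟩).isClosed_compl, by rwa [compl_compl]⟩, ?_⟩
    ext ⟨p⟩
    obtain ⟨x, rfl⟩ := exists_thomPoint_eq e p
    have hx : thomPoint e x u ↔ x ∉ U := by
      rw [thomPoint_apply, hu]; rfl
    change ¬ thomPoint e x u ↔ _
    rw [hx, not_not]
    constructor
    · exact fun h => ⟨x, h, rfl⟩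
    · rintro ⟨y, hy, hyx⟩
      obtain rfl := thomPoint_injective e (congrArg HochsterDual.point hyx)
      exact hy

end Noetherian

/-! ### Cocycle projections and null-homotopic scalars. -/

section Cocycles

variable {R : Type u} [CommRing R]

lemma ModComplex.d_d_apply (E : ModComplex R) (i j k : ℤ) (x : E.X i) :
    (E.d j k).hom ((E.d i j).hom x) = 0 :=
  congr($(congrArg ModuleCat.Hom.hom (E.d_comp_d i j k)) x)

/-- The coboundaries, as a submodule of the cocycles. -/
abbrev ModComplex.coboundaries (E : ModComplex R) (i j k : ℤ) :
    Submodule R (LinearMap.ker (E.d j k).hom) :=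
  LinearMap.range ((E.d i j).hom.codRestrict (LinearMap.ker (E.d j k).hom)
    (E.d_d_apply i j k))

/-- Homology is cocycles modulo coboundaries. -/
noncomputable def ModComplex.homologyEquiv (E : ModComplex R) (i j k : ℤ) (hij : i + 1 = j)
    (hjk : j + 1 = k) : E.homology j ≃ₗ[R] (LinearMap.ker (E.d j k).hom ⧸
      E.coboundaries i j k) :=
  ((E.homologyIsoSc' i j k (by simp; omega) (by simp; omega)).trans
    (ShortComplex.moduleCatHomologyIso _)).toLinearEquiv

lemma ModComplex.mem_annihilator_homology_iff (E : ModComplex R) (i j k : ℤ) (hij : i + 1 = j)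
    (hjk : j + 1 = k) (s : R) : s ∈ Module.annihilator R (E.homology j) ↔
      ∀ z : E.X j, (E.d j k).hom z = 0 → ∃ y : E.X i, (E.d i j).hom y = s • z := by
  rw [(E.homologyEquiv i j k hij hjk).annihilator_eq, Module.mem_annihilator]
  constructor
  · intro h z hz
    have := h (Submodule.Quotient.mk ⟨z, hz⟩)
    rw [← Submodule.Quotient.mk_smul, Submodule.Quotient.mk_eq_zero] at this
    obtain ⟨y, hy⟩ := this
    exact ⟨y, congrArg Subtype.val hy⟩
  · intro h m
    obtain ⟨⟨z, hz⟩, rfl⟩ := Submodule.Quotient.mk_surjective _ m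
    rw [← Submodule.Quotient.mk_smul, Submodule.Quotient.mk_eq_zero]
    obtain ⟨y, hy⟩ := h z hz
    exact ⟨y, Subtype.ext hy⟩

lemma ModComplex.finite_homology [IsNoetherianRing R] (E : ModComplex R) (j : ℤ)
    [Module.Finite R (E.X j)] : Module.Finite R (E.homology j) :=
  Module.Finite.equiv (E.homologyEquiv (j - 1) j (j + 1) (by omega) rfl).symm

/-- A family of linear endomorphisms that projects a complex onto its cocycles. -/
lemma IsStrictlyPerfect.exists_cocycle_projection [IsDomain R] [IsPrincipalIdealRing R]
    {E : ModComplex R} (hE : IsStrictlyPerfect R E) :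
    ∃ p : ∀ i : ℤ, E.X i →ₗ[R] E.X i, (∀ i j x, (E.d i j).hom (p i x) = 0) ∧
      ∀ i x, (E.d i (i + 1)).hom x = 0 → p i x = x := by
  have h : ∀ i : ℤ, ∃ σ : LinearMap.range (E.d i (i + 1)).hom →ₗ[R] E.X i,
      ∀ y, (E.d i (i + 1)).hom (σ y) = y := fun i => by
    have := hE.finite i
    have := hE.projective (i + 1)
    -- The image of the differential is projective, as a submodule of a finitely generated
    -- projective module over a principal ideal domain; with a section `σ`, the map `1 - σ d`
    -- projects onto the cocycles.
    obtain ⟨σ, hσ⟩ := Module.projective_lifting_property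
      (E.d i (i + 1)).hom.rangeRestrict LinearMap.id (LinearMap.surjective_rangeRestrict _)
    exact ⟨σ, fun y => congrArg Subtype.val (LinearMap.congr_fun hσ y)⟩
  choose σ hσ using h
  refine ⟨fun i => LinearMap.id - (σ i).comp (E.d i (i + 1)).hom.rangeRestrict,
    fun i j x => ?_, fun i x hx => ?_⟩
  · by_cases hij : i + 1 = j
    · subst hij
      simp [hσ]
    · rw [E.shape i j hij]
      rfl
  · have : (E.d i (i + 1)).hom.rangeRestrict x = 0 := Subtype.ext hx
    simp [this]

/-- Since `s` times a cocycle is a coboundary, `s • p` lifts through `d` to a map `g`, and the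
homotopy is `(1 - p) g`. Cocycles die under `d`, so `d (1 - p) g = s • p`. Moreover `g (d x) - s •
x` is a cocycle, so `(1 - p) g d = s • (1 - p)`. The two terms add up to `s`. -/
lemma ModComplex.nonempty_homotopy_smul {E : ModComplex R} (hP : ∀ i, Module.Projective R (E.X i))
    (p : ∀ i : ℤ, E.X i →ₗ[R] E.X i) (hp : ∀ i j x, (E.d i j).hom (p i x) = 0)
    (hp' : ∀ i x, (E.d i (i + 1)).hom x = 0 → p i x = x) (s : R)
    (hs : ∀ i, s ∈ Module.annihilator R (E.homology i)) :
    Nonempty (Homotopy (s • 𝟙 E) 0) := by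
  have hg : ∀ i j : ℤ, i + 1 = j → ∃ g : E.X j →ₗ[R] E.X i,
      ∀ x, (E.d i j).hom (g x) = s • p j x := fun i j hij => by
    obtain ⟨g, hg⟩ := Module.projective_lifting_property (E.d i j).hom.rangeRestrict
      ((s • p j).codRestrict (LinearMap.range (E.d i j).hom) fun x =>
        (E.mem_annihilator_homology_iff i j (j + 1) hij rfl s).1 (hs j) _ (hp _ _ x))
      (LinearMap.surjective_rangeRestrict _)
    exact ⟨g, fun x => congrArg Subtype.val (LinearMap.congr_fun hg x)⟩
  choose g hg using hg
  let h : ∀ j i : ℤ, (ComplexShape.up ℤ).Rel i j → (E.X j ⟶ E.X i) := fun j i hij =>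
    ModuleCat.ofHom ((LinearMap.id - p i).comp (g i j hij))
  have key : Homotopy.nullHomotopicMap' h = s • 𝟙 E := by
    ext i x
    rw [Homotopy.nullHomotopicMap'_f (k₂ := i - 1) (k₁ := i) (k₀ := i + 1) (by simp) rfl h]
    have h1 := hg i (i + 1) rfl ((E.d i (i + 1)).hom x)
    rw [hp' (i + 1) _ (E.d_d_apply _ _ _ _)] at h1
    have h2 : p i (g i (i + 1) rfl ((E.d i (i + 1)).hom x) - s • x) =
        g i (i + 1) rfl ((E.d i (i + 1)).hom x) - s • x := hp' i _ (by
      rw [map_sub, h1, map_smul, sub_self])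
    have h3 := hg (i - 1) i (by omega) x
    rw [map_sub, map_smul] at h2
    change (g i (i + 1) rfl ((E.d i (i + 1)).hom x) - p i (g i (i + 1) rfl ((E.d i (i + 1)).hom x)))
      + (E.d (i - 1) i).hom (g (i - 1) i _ x - p (i - 1) (g (i - 1) i _ x)) = s • x
    rw [map_sub, hp, sub_zero, h3]
    have h4 : g i (i + 1) rfl ((E.d i (i + 1)).hom x) -
      p i (g i (i + 1) rfl ((E.d i (i + 1)).hom x)) = s • x - s • p i x := by
      rw [sub_eq_sub_iff_add_eq_add]
      rw [sub_eq_sub_iff_add_eq_add] at h2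
      rw [← h2]
      abel
    rw [h4, sub_add_cancel]
  exact ⟨key ▸ Homotopy.nullHomotopy' h⟩

end Cocycles

/-! ### The subcategories `P(𝔭)` via scalars that act as zero. -/

section PrimeOf

variable {R : Type u} [CommRing R]

lemma DPerf.smul_id_eq_zero_iff (E : DPerf R) (s : R) :
    s • 𝟙 E = 0 ↔ (KMod.Q R).map (s • 𝟙 E.cpx) = 0 := by
  rw [Functor.map_smul, CategoryTheory.Functor.map_id]
  constructor
  · exact fun h => congrArg (fun f : E ⟶ E => f.hom) h
  · exact fun h => InducedCategory.hom_ext h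

lemma DPerf.smul_id_eq_zero_iff_homotopy (E : DPerf R) (s : R) :
    s • 𝟙 E = 0 ↔ Nonempty (Homotopy (s • 𝟙 E.cpx) 0) := by
  rw [DPerf.smul_id_eq_zero_iff]
  constructor
  · exact fun h => ⟨HomotopyCategory.homotopyOfEq _ _ (h.trans (Functor.map_zero _ _ _).symm)⟩
  · rintro ⟨h⟩
    exact (HomotopyCategory.eq_of_homotopy _ _ h).trans (Functor.map_zero _ _ _)

lemma ModComplex.smul_eq_d_of_homotopy {E : ModComplex R} {s : R} (h : Homotopy (s • 𝟙 E) 0)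
    (i j : ℤ) (hij : i + 1 = j) (z : E.X j) (hz : (E.d j (j + 1)).hom z = 0) :
    ∃ y : E.X i, (E.d i j).hom y = s • z := by
  refine ⟨(h.hom j i).hom z, ?_⟩
  have h1 := congr($(congrArg ModuleCat.Hom.hom (h.comm j)) z)
  rw [dNext_eq h.hom (show (ComplexShape.up ℤ).Rel j (j + 1) from rfl),
    prevD_eq h.hom (show (ComplexShape.up ℤ).Rel i j from hij)] at h1
  have h2 : s • z = (h.hom (j + 1) j).hom ((E.d j (j + 1)).hom z) +
      (E.d i j).hom ((h.hom j i).hom z) := by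
    simpa using h1
  rw [h2, hz, map_zero, zero_add]

lemma primeOf_of_smul_eq_zero {𝔭 : PrimeSpectrum R} {E : DPerf R} {s : R} (hs : s ∉ 𝔭.asIdeal)
    (h : s • 𝟙 E = 0) : primeOf 𝔭 E := by
  obtain ⟨h⟩ := (E.smul_id_eq_zero_iff_homotopy s).1 h
  intro i
  have : s ∈ Module.annihilator R (E.cpx.homology i) :=
    (E.cpx.mem_annihilator_homology_iff (i - 1) i (i + 1) (by omega) rfl s).2
      fun z hz => ModComplex.smul_eq_d_of_homotopy h _ _ (by omega) z hz
  exact LocalizedModule.subsingleton_iff.2 fun m => ⟨s, hs, Module.mem_annihilator.1 this m⟩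

variable [IsDomain R] [IsPrincipalIdealRing R]

lemma DPerf.smul_id_eq_zero (E : DPerf R) {s : R}
    (hs : ∀ i, s ∈ Module.annihilator R (E.cpx.homology i)) : s • 𝟙 E = 0 := by
  obtain ⟨p, hp, hp'⟩ := IsStrictlyPerfect.exists_cocycle_projection E.property
  exact (E.smul_id_eq_zero_iff_homotopy s).2
    (ModComplex.nonempty_homotopy_smul E.property.projective p hp hp' s hs)

/-- This turns a condition on localized cohomology into one on the `R`-linear category, where
closure properties are formal. Finite generation gives in each degree an annihilator of cohomology
outside `𝔭`. -/
lemma primeOf_iff {𝔭 : PrimeSpectrum R} {E : DPerf R} :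
    primeOf 𝔭 E ↔ ∃ s ∉ 𝔭.asIdeal, s • 𝟙 E = 0 := by
  refine ⟨fun h => ?_, fun ⟨s, hs, h⟩ => primeOf_of_smul_eq_zero hs h⟩
  obtain ⟨a, b, hab⟩ := IsStrictlyPerfect.bounded E.property
  have hfin : ∀ i, Module.Finite R (E.cpx.X i) := E.property.finite
  have hi : ∀ i, ∃ s ∉ 𝔭.asIdeal, s ∈ Module.annihilator R (E.cpx.homology i) := fun i => by
    have := E.cpx.finite_homology i
    have hi := Module.notMem_support_iff.2 (h i)
    rw [Module.support_eq_zeroLocus, PrimeSpectrum.mem_zeroLocus, Set.not_subset] at hi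
    obtain ⟨s, hs, hs'⟩ := hi
    exact ⟨s, hs', hs⟩
  choose s hs hs' using hi
  -- The product over the finitely many degrees where `E` may be nonzero kills all cohomology and
  -- stays outside the prime `𝔭`.
  refine ⟨∏ i ∈ Finset.Icc a b, s i, fun hc => ?_, E.smul_id_eq_zero fun i => ?_⟩
  · obtain ⟨i, -, hi⟩ := (Ideal.IsPrime.prod_mem_iff (hp := 𝔭.isPrime)).1 hc
    exact hs i hi
  · by_cases hi : i ∈ Finset.Icc a b
    · exact Ideal.mem_of_dvd _ (Finset.dvd_prod_of_mem s hi) (hs' i)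
    · rw [E.cpx.mem_annihilator_homology_iff (i - 1) i (i + 1) (by omega) rfl]
      intro z _
      have := ModuleCat.subsingleton_of_isZero (hab i (by
        simp only [Finset.mem_Icc] at hi; omega))
      exact ⟨0, Subsingleton.elim _ _⟩

end PrimeOf

section ShiftLinear

variable {R : Type u} [CommRing R]

/-- Linearity of the shift is inherited from the ambient homotopy category along the faithful
inclusion. -/
instance DPerf.linear_shift (n : ℤ) : (shiftFunctor (DPerf R) n).Linear R where
  map_smul {X Y} f r := by
    have h := fun g : X ⟶ Y => ((perfProp R).ι.commShiftIso n).hom.naturality g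
    have h1 := h f
    have h2 := h (r • f)
    have h3 : (perfProp R).ι.map (r • f) = r • (perfProp R).ι.map f := rfl
    simp only [Functor.comp_map] at h1 h2
    rw [h3, (shiftFunctor (KMod R) n).map_smul, Linear.comp_smul, ← h1, ← Linear.smul_comp] at h2
    exact (perfProp R).ι.map_injective ((cancel_mono _).1 h2)

end ShiftLinear

section PrimeOfThick

variable {R : Type u} [CommRing R] [IsDomain R] [IsPrincipalIdealRing R] (𝔭 : PrimeSpectrum R)

lemma isThick_primeOf : IsThick (primeOf 𝔭) where
  triangulated :=
    { exists_zero := ⟨0, isZero_zero _, primeOf_of_smul_eq_zero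
        (𝔭.asIdeal.ne_top_iff_one.1 𝔭.isPrime.ne_top) ((isZero_zero _).eq_of_src _ _)⟩
      isStableUnderShiftBy := fun n => ⟨fun X hX => by
        obtain ⟨s, hs, h⟩ := primeOf_iff.1 hX
        refine primeOf_of_smul_eq_zero hs ?_
        have := congrArg (shiftFunctor (DPerf R) n).map h
        rwa [Functor.map_smul, CategoryTheory.Functor.map_id, Functor.map_zero] at this⟩
      ext₂' := fun T hT h₁ h₃ => ObjectProperty.le_isoClosure _ _ <| by
        obtain ⟨s, hs, h⟩ := primeOf_iff.1 h₁
        obtain ⟨t, ht, h'⟩ := primeOf_iff.1 h₃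
        refine primeOf_of_smul_eq_zero (s := s * t) (fun hc => ?_) ?_
        · exact (𝔭.isPrime.mem_or_mem hc).elim hs ht
        -- As `t` kills the third object, `t` on the middle object factors through the first, where
        -- `s` vanishes.
        · obtain ⟨f, hf⟩ := Triangle.coyoneda_exact₂ T hT (t • 𝟙 T.obj₂) (by
            rw [Linear.smul_comp, Category.id_comp, ← Category.comp_id T.mor₂,
              ← Linear.comp_smul, h', comp_zero])
          rw [mul_smul, hf, ← Linear.smul_comp, ← Category.comp_id f, ← Linear.comp_smul, h,
            comp_zero, zero_comp] }
  retracts := ⟨fun {X Y} r hY => by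
    obtain ⟨s, hs, h⟩ := primeOf_iff.1 hY
    refine primeOf_of_smul_eq_zero hs ?_
    rw [← r.retract, ← Linear.comp_smul, ← Category.id_comp r.r, ← Linear.smul_comp, h,
      zero_comp, comp_zero]⟩

lemma isThickTensorIdeal_primeOf : IsThickTensorIdeal (primeOf 𝔭) where
  toIsThick := isThick_primeOf 𝔭
  tensor X Y hY := by
    obtain ⟨s, hs, h⟩ := primeOf_iff.1 hY
    refine primeOf_of_smul_eq_zero hs ?_
    rw [DPerf.smul_id_eq_zero_iff] at h ⊢
    have h1 := KMod.whiskerLeft_homotopic X.cpx (h.trans (Functor.map_zero _ _ _).symm)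
    have h2 : X.cpx ◁ (0 : Y.cpx ⟶ Y.cpx) = 0 := by
      refine HomologicalComplex.hom_ext _ _ fun n =>
        HomologicalComplex.mapBifunctor.hom_ext fun i j hij => ?_
      refine (HomologicalComplex.ι_mapBifunctorMap _ _ _ _ i j n hij).trans ?_
      simp
    -- Maps out of the total complex are compared on the summands `X^i ⊗ Y^j`.
    have h3 : X.cpx ◁ (s • 𝟙 Y.cpx) = s • 𝟙 (X.cpx ⊗ Y.cpx) := by
      refine HomologicalComplex.hom_ext _ _ fun n =>
        HomologicalComplex.mapBifunctor.hom_ext fun i j hij => ?_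
      refine (HomologicalComplex.ι_mapBifunctorMap _ _ _ _ i j n hij).trans ?_
      simp only [HomologicalComplex.smul_f_apply, HomologicalComplex.id_f, Functor.map_smul,
        CategoryTheory.Functor.map_id, NatTrans.id_app, Category.id_comp, Linear.smul_comp]
      refine Eq.trans ?_ (Linear.comp_smul _ _ _ (HomologicalComplex.ιMapBifunctor X.cpx Y.cpx
        (curriedTensor (ModuleCat R)) (ComplexShape.up ℤ) i j n hij) s (𝟙 _)).symm
      rw [Category.comp_id]
    rw [h2, h3, Functor.map_zero] at h1
    exact h1

end PrimeOfThick

/-! ### Primality of `P(𝔭)` through residue field functionals. -/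

section TensorPrime

variable {R : Type u} [CommRing R]

/-- At a prime of the support the fibre `κ(𝔭) ⊗ M` is nonzero, and linear functionals on a vector
space separate points. -/
lemma exists_functional_of_mem_support {M : Type u} [AddCommGroup M] [Module R M]
    [Module.Finite R M] {𝔭 : PrimeSpectrum R} (h : 𝔭 ∈ Module.support R M) :
    ∃ (f : M →ₗ[R] 𝔭.asIdeal.ResidueField) (m : M), f m ≠ 0 := by
  rw [Module.mem_support_iff_nontrivial_residueField_tensorProduct] at h
  obtain ⟨v, hv⟩ := exists_ne (0 : TensorProduct R 𝔭.asIdeal.ResidueField M)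
  by_contra! hc
  refine hv ((Module.forall_dual_apply_eq_zero_iff 𝔭.asIdeal.ResidueField v).1 fun g => ?_)
  have : g = 0 := by
    ext m
    exact hc ((g.restrictScalars R).comp (TensorProduct.mk R 𝔭.asIdeal.ResidueField M 1)) m
  rw [this, LinearMap.zero_apply]

/-- A functional on cohomology that is nonzero on some class is extended to all cochains by the
cocycle projection. It vanishes on coboundaries and detects a cocycle that represents the class. -/
lemma exists_functional_of_not_primeOf [IsDomain R] [IsPrincipalIdealRing R]
    {𝔭 : PrimeSpectrum R} {E : DPerf R} (hE : ¬ primeOf 𝔭 E) :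
    ∃ (f : ∀ i, E.cpx.X i →ₗ[R] 𝔭.asIdeal.ResidueField) (i : ℤ) (x : E.cpx.X i),
      (∀ i j x, f j ((E.cpx.d i j).hom x) = 0) ∧ (∀ j, (E.cpx.d i j).hom x = 0) ∧ f i x ≠ 0 := by
  obtain ⟨p, hp, hp'⟩ := IsStrictlyPerfect.exists_cocycle_projection E.property
  obtain ⟨j, hj⟩ := not_forall.1 hE
  have hfin : Module.Finite R (E.cpx.X j) := IsStrictlyPerfect.finite E.property j
  have := E.cpx.finite_homology j
  obtain ⟨f, m, hfm⟩ := exists_functional_of_mem_support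
    (not_not.1 fun h => hj (Module.notMem_support_iff.1 h))
  let e := E.cpx.homologyEquiv (j - 1) j (j + 1) (by omega) rfl
  let f' : E.cpx.X j →ₗ[R] 𝔭.asIdeal.ResidueField :=
    f.comp (e.symm.toLinearMap.comp ((Submodule.mkQ _).comp
      ((p j).codRestrict _ (fun x => hp j (j + 1) x))))
  obtain ⟨⟨z, hz⟩, hzm⟩ := Submodule.Quotient.mk_surjective _ (e m)
  have hzj : ∀ k, (E.cpx.d j k).hom z = 0 := fun k => by
    by_cases hk : j + 1 = k
    · subst hk; exact hz
    · rw [E.cpx.shape j k hk]; rfl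
  have hf' : f' z = f m := by
    have h1 : (p j).codRestrict _ (fun x => hp j (j + 1) x) z = ⟨z, hz⟩ :=
      Subtype.ext (hp' j z hz)
    have h2 : f' z = f (e.symm (Submodule.Quotient.mk
      ((p j).codRestrict _ (fun x => hp j (j + 1) x) z))) := rfl
    rw [h2, h1, hzm, e.symm_apply_apply]
  refine ⟨Pi.single j f', j, z, fun a b x => ?_, hzj, ?_⟩
  · by_cases hb : b = j
    · subst hb
      rw [Pi.single_eq_same]
      by_cases hab : a + 1 = b
      · obtain rfl : a = b - 1 := by omega
        have h1 : (p b).codRestrict (LinearMap.ker (E.cpx.d b (b + 1)).hom)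
            (fun x => hp b (b + 1) x) ((E.cpx.d (b - 1) b).hom x) =
            (E.cpx.d (b - 1) b).hom.codRestrict _ (E.cpx.d_d_apply (b - 1) b (b + 1)) x :=
          Subtype.ext (hp' b _ (E.cpx.d_d_apply _ _ _ _))
        have h2 : f' ((E.cpx.d (b - 1) b).hom x) = f (e.symm (Submodule.Quotient.mk
          ((p b).codRestrict _ (fun x => hp b (b + 1) x) ((E.cpx.d (b - 1) b).hom x)))) := rfl
        rw [h2, h1, (Submodule.Quotient.mk_eq_zero _).2 (LinearMap.mem_range_self _ x),
          map_zero, map_zero]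
      · rw [E.cpx.shape a b hab]
        exact map_zero _
    · rw [Pi.single_eq_of_ne hb]
      rfl
  · rw [Pi.single_eq_same, hf']
    exact hfm

variable {𝔭 : PrimeSpectrum R} (E F : ModComplex R)
  (f : ∀ i, E.X i →ₗ[R] 𝔭.asIdeal.ResidueField) (g : ∀ i, F.X i →ₗ[R] 𝔭.asIdeal.ResidueField)

/-- The product of two families of functionals, on the tensor product of complexes. -/
noncomputable def tensorFunctional (n : ℤ) :
    (HomologicalComplex.mapBifunctor E F (curriedTensor (ModuleCat.{u} R))
      (ComplexShape.up ℤ)).X n ⟶ ModuleCat.of R 𝔭.asIdeal.ResidueField :=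
  HomologicalComplex.mapBifunctorDesc fun i j _ =>
    ModuleCat.ofHom ((LinearMap.mul' R 𝔭.asIdeal.ResidueField).comp
      (TensorProduct.map (f i) (g j)))

lemma ι_tensorFunctional (i j n : ℤ) (h : i + j = n) (x : E.X i) (y : F.X j) :
    (tensorFunctional E F f g n).hom ((HomologicalComplex.ιMapBifunctor E F
      (curriedTensor (ModuleCat.{u} R)) (ComplexShape.up ℤ) i j n h).hom (x ⊗ₜ y)) =
    f i x * g j y := by
  have h := HomologicalComplex.ι_mapBifunctorDesc (K₁ := E) (K₂ := F)
    (F := curriedTensor (ModuleCat.{u} R)) (c := ComplexShape.up ℤ) (j := n)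
    (A := ModuleCat.of R 𝔭.asIdeal.ResidueField)
    (fun i j _ => ModuleCat.ofHom ((LinearMap.mul' R 𝔭.asIdeal.ResidueField).comp
      (TensorProduct.map (f i) (g j)))) i j h
  exact congr($(congrArg ModuleCat.Hom.hom h) (x ⊗ₜ[R] y))

/-- The signs are left unspecified because in every application both terms vanish. -/
lemma ι_tensor_d (i j n : ℤ) (h : i + j = n) (x : E.X i) (y : F.X j) :
    ∃ ε₁ ε₂ : ℤˣ, ((E ⊗ F).d n (n + 1)).hom ((HomologicalComplex.ιMapBifunctor E F
      (curriedTensor (ModuleCat.{u} R)) (ComplexShape.up ℤ) i j n h).hom (x ⊗ₜ y)) =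
    ε₁ • (HomologicalComplex.ιMapBifunctor E F (curriedTensor (ModuleCat.{u} R))
      (ComplexShape.up ℤ) (i + 1) j (n + 1) (by dsimp; omega)).hom ((E.d i (i + 1)).hom x ⊗ₜ y) +
    ε₂ • (HomologicalComplex.ιMapBifunctor E F (curriedTensor (ModuleCat.{u} R))
      (ComplexShape.up ℤ) i (j + 1) (n + 1) (by dsimp; omega)).hom
        (x ⊗ₜ (F.d j (j + 1)).hom y) := by
  have h1 := HomologicalComplex.mapBifunctor.ι_D₁ E F (curriedTensor (ModuleCat.{u} R))
    (ComplexShape.up ℤ) n (n + 1) i j h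
  have h2 := HomologicalComplex.mapBifunctor.ι_D₂ E F (curriedTensor (ModuleCat.{u} R))
    (ComplexShape.up ℤ) n (n + 1) i j h
  rw [HomologicalComplex.mapBifunctor.d₁_eq E F _ _
    (show (ComplexShape.up ℤ).Rel i (i + 1) from rfl) j (n + 1) (by dsimp; omega)] at h1
  rw [HomologicalComplex.mapBifunctor.d₂_eq E F _ _ i
    (show (ComplexShape.up ℤ).Rel j (j + 1) from rfl) (n + 1) (by dsimp; omega)] at h2
  refine ⟨_, _, congrArg₂ (· + ·) (congr($(congrArg ModuleCat.Hom.hom h1) (x ⊗ₜ y)))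
    (congr($(congrArg ModuleCat.Hom.hom h2) (x ⊗ₜ y)))⟩

variable {E F f g}

lemma tensorFunctional_d (hf : ∀ i j x, f j ((E.d i j).hom x) = 0)
    (hg : ∀ i j x, g j ((F.d i j).hom x) = 0) (n : ℤ) (t : (E ⊗ F).X n) :
    (tensorFunctional E F f g (n + 1)).hom (((E ⊗ F).d n (n + 1)).hom t) = 0 := by
  suffices h : (E ⊗ F).d n (n + 1) ≫ tensorFunctional E F f g (n + 1) = 0 from
    congr($(congrArg ModuleCat.Hom.hom h) t)
  refine HomologicalComplex.mapBifunctor.hom_ext fun i j hij => ?_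
  refine ModuleCat.hom_ext (TensorProduct.ext' fun x y => ?_)
  obtain ⟨ε₁, ε₂, h⟩ := ι_tensor_d E F i j n hij x y
  refine (congrArg (tensorFunctional E F f g (n + 1)).hom h).trans ?_
  have h1 := ι_tensorFunctional E F f g (i + 1) j (n + 1) (by dsimp at hij; omega)
    ((E.d i (i + 1)).hom x) y
  have h2 := ι_tensorFunctional E F f g i (j + 1) (n + 1) (by dsimp at hij; omega)
    x ((F.d j (j + 1)).hom y)
  rw [hf, zero_mul] at h1
  rw [hg, mul_zero] at h2
  rw [map_add, Units.smul_def, Units.smul_def, map_zsmul, map_zsmul, h1, h2]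
  simp

/-- If `s ∉ 𝔭` acts as zero on `X ⊗ Y`, then `s • (x ⊗ y)` is a coboundary for the detected cocycles
`x` and `y`. The product functional kills it, so `s f(x) g(y) = 0` in the residue field, where all
three factors are nonzero. -/
lemma primeOf_mem_or_mem [IsDomain R] [IsPrincipalIdealRing R] (𝔭 : PrimeSpectrum R)
    (X Y : DPerf R) (h : primeOf 𝔭 (X ⊗ Y)) : primeOf 𝔭 X ∨ primeOf 𝔭 Y := by
  by_contra! hc
  obtain ⟨f, i, x, hf, hx, hfx⟩ := exists_functional_of_not_primeOf hc.1
  obtain ⟨g, j, y, hg, hy, hgy⟩ := exists_functional_of_not_primeOf hc.2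
  obtain ⟨s, hs, h⟩ := primeOf_iff.1 h
  obtain ⟨H⟩ := (DPerf.smul_id_eq_zero_iff_homotopy _ s).1 h
  obtain ⟨ε₁, ε₂, hd⟩ := ι_tensor_d X.cpx Y.cpx i j (i + j) rfl x y
  rw [hx, hy, TensorProduct.zero_tmul, TensorProduct.tmul_zero, map_zero, map_zero, smul_zero,
    smul_zero, add_zero] at hd
  obtain ⟨t, ht⟩ := ModComplex.smul_eq_d_of_homotopy H (i + j - 1) (i + j) (by omega) _ hd
  have h1 := tensorFunctional_d hf hg (i + j - 1)
  rw [sub_add_cancel] at h1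
  have h2 := h1 t
  have h3 := (congrArg (tensorFunctional X.cpx Y.cpx f g (i + j)).hom ht).symm.trans h2
  have h4 := ι_tensorFunctional X.cpx Y.cpx f g i j (i + j) rfl x y
  have h5 : s • (f i x * g j y) = 0 := (congrArg (s • ·) h4).symm.trans
    (((tensorFunctional X.cpx Y.cpx f g (i + j)).hom.map_smul s _).symm.trans h3)
  rw [Algebra.smul_def] at h5
  refine (mul_ne_zero ?_ (mul_ne_zero hfx hgy)) h5
  rwa [Ne, Ideal.algebraMap_residueField_eq_zero]

end TensorPrime

/-! ### Cones of scalars in a linear triangulated category. -/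

section Cones

variable {R : Type u} [CommRing R]
variable {K : Type v} [Category.{w} K] [HasZeroObject K] [Preadditive K] [HasShift K ℤ]
  [∀ n : ℤ, (shiftFunctor K n).Additive] [Pretriangulated K] [Linear R K]

/-- `X` is a cone of the multiplication by `a` on `A`. -/
def IsCone (a : R) (A X : K) : Prop :=
  ∃ (g : A ⟶ X) (h : X ⟶ A⟦(1 : ℤ)⟧), Triangle.mk (a • 𝟙 A) g h ∈ distTriang K

lemma exists_isCone (a : R) (A : K) : ∃ X, IsCone a A X :=
  distinguished_cocone_triangle (a • 𝟙 A)

lemma IsThick.prop_of_iso {J : ObjectProperty K} (hJ : IsThick J) {X Y : K} (e : X ≅ Y)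
    (hX : J X) : J Y :=
  have := hJ.retracts
  J.prop_of_iso e hX

lemma IsThick.prop_shift {J : ObjectProperty K} (hJ : IsThick J) {X : K} (hX : J X) (n : ℤ) :
    J (X⟦n⟧) :=
  have := hJ.triangulated
  J.le_shift n X hX

lemma IsThick.prop_of_isZero {J : ObjectProperty K} (hJ : IsThick J) {X : K} (hX : IsZero X) :
    J X :=
  have := hJ.triangulated
  have := hJ.retracts
  J.prop_of_isZero hX

lemma IsCone.prop {J : ObjectProperty K} (hJ : IsThick J) {a : R} {A X : K} (h : IsCone a A X)
    (hA : J A) : J X := by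
  have := hJ.triangulated
  have := hJ.retracts
  obtain ⟨_, _, hT⟩ := h
  exact J.ext_of_isTriangulatedClosed₃ _ hT hA hA

lemma IsCone.isZero_of_isUnit {a : R} (ha : IsUnit a) {A X : K} (h : IsCone a A X) :
    IsZero X := by
  obtain ⟨g, f, hT⟩ := h
  obtain ⟨b, hb⟩ := ha.exists_right_inv
  have h1 : (a • 𝟙 A) ≫ (b • 𝟙 A) = 𝟙 A := by
    simp [smul_smul, mul_comm b a, hb]
  have h2 : (b • 𝟙 A) ≫ (a • 𝟙 A) = 𝟙 A := by
    simp [smul_smul, hb]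
  exact Triangle.isZero₃_of_isIso₁ _ hT ⟨b • 𝟙 A, h1, h2⟩

lemma IsCone.of_iso {a : R} {A A' X X' : K} (h : IsCone a A X) (e : A ≅ A') (e' : X ≅ X') :
    IsCone a A' X' := by
  obtain ⟨g, f, hT⟩ := h
  have h1 : (a • 𝟙 A') ≫ e.inv = e.inv ≫ (a • 𝟙 A) := by simp
  have h2 : (e.inv ≫ g ≫ e'.hom) ≫ e'.inv = e.inv ≫ g := by simp
  have h3 : (e'.inv ≫ f ≫ e.hom⟦(1 : ℤ)⟧') ≫ e.inv⟦(1 : ℤ)⟧' = e'.inv ≫ f := by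
    simp [← Functor.map_comp]
  exact ⟨_, _, isomorphic_distinguished _ hT _
    (Triangle.isoMk _ _ e.symm e.symm e'.symm h1 h2 h3)⟩

lemma IsCone.shift [∀ n : ℤ, (shiftFunctor K n).Linear R] {a : R} {A X : K}
    (h : IsCone a A X) (n : ℤ) : IsCone a (A⟦n⟧) (X⟦n⟧) := by
  obtain ⟨g, f, hT⟩ := h
  have h0 : n.negOnePow * n.negOnePow = 1 := Int.units_mul_self _
  -- Shifting a triangle puts the sign `(-1)^n` on its maps; this automorphism of the middle vertex
  -- removes it from the first two.
  let e : A⟦n⟧ ≅ A⟦n⟧ := ⟨n.negOnePow • 𝟙 _, n.negOnePow • 𝟙 _,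
    by simp [smul_smul, h0], by simp [smul_smul, h0]⟩
  have h1 : (a • 𝟙 (A⟦n⟧)) ≫ e.hom = 𝟙 _ ≫ (n.negOnePow • (a • 𝟙 A)⟦n⟧') := by
    simp only [e, Functor.map_smul, CategoryTheory.Functor.map_id, Category.id_comp,
      Linear.smul_comp]
    exact smul_comm _ _ _
  have h2 : g⟦n⟧' ≫ 𝟙 (X⟦n⟧) = e.hom ≫ (n.negOnePow • g⟦n⟧') := by
    simp [e, smul_smul, h0]
  have h3 : (n.negOnePow • f⟦n⟧' ≫ (shiftFunctorComm K 1 n).hom.app A) ≫ (𝟙 (A⟦n⟧))⟦(1 : ℤ)⟧' =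
      𝟙 (X⟦n⟧) ≫ (n.negOnePow • f⟦n⟧' ≫ (shiftFunctorComm K 1 n).hom.app A) := by
    rw [CategoryTheory.Functor.map_id, Category.id_comp]
    exact Category.comp_id _
  exact ⟨_, _, isomorphic_distinguished _ (Triangle.shift_distinguished _ hT n) _
    (Triangle.isoMk (Triangle.mk (a • 𝟙 (A⟦n⟧)) (g⟦n⟧')
      (n.negOnePow • f⟦n⟧' ≫ (shiftFunctorComm K 1 n).hom.app A)) _
      (Iso.refl _) e (Iso.refl _) h1 h2 h3)⟩

/-- The octahedral axiom for `a` followed by `b` places the cone of `a * b` between the cones of `a`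
and `b`. -/
lemma IsCone.prop_mul [IsTriangulated K] {J : ObjectProperty K} (hJ : IsThick J) {a b : R}
    {A X Y Z : K} (hX : IsCone a A X) (hY : IsCone b A Y) (hZ : IsCone (a * b) A Z)
    (hJX : J X) (hJY : J Y) : J Z := by
  have := hJ.triangulated
  have := hJ.retracts
  obtain ⟨_, _, hX⟩ := hX
  obtain ⟨_, _, hY⟩ := hY
  obtain ⟨_, _, hZ⟩ := hZ
  have comm : (a • 𝟙 A) ≫ (b • 𝟙 A) = (a * b) • 𝟙 A := by
    simp [smul_smul, mul_comm]
  exact J.ext_of_isTriangulatedClosed₂ _ (Triangulated.someOctahedron comm hX hY hZ).mem hJX hJY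

/-- An object with scalar endomorphisms and no endomorphism of degree `-1`. -/
structure IsRigidUnit (R : Type u) [CommRing R] [Linear R K] (A : K) : Prop where
  exists_smul : ∀ f : A ⟶ A, ∃ r : R, f = r • 𝟙 A
  smul_injective : ∀ r : R, r • 𝟙 A = 0 → r = 0
  shift_hom : ∀ f : A⟦(1 : ℤ)⟧ ⟶ A, f = 0

/-- Endomorphisms of the cone are determined by their restriction to `A`. Here `f` factors as `h ≫
v`; the composite `v ≫ h` is a scalar killed by `b`, hence zero, so `v` factors through a map `A⟦1⟧
⟶ A`, which vanishes. -/
lemma IsRigidUnit.eq_zero [IsDomain R] {A : K} (hA : IsRigidUnit R A) {b : R} (hb : b ≠ 0) {X : K}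
    {g : A ⟶ X} {h : X ⟶ A⟦(1 : ℤ)⟧} (hT : Triangle.mk (b • 𝟙 A) g h ∈ distTriang K) {f : X ⟶ X}
    (hf : g ≫ f = 0) : f = 0 := by
  obtain ⟨v, hv⟩ : ∃ v : A⟦(1 : ℤ)⟧ ⟶ X, f = h ≫ v := Triangle.yoneda_exact₃ _ hT f hf
  suffices v = 0 by rw [hv, this, comp_zero]
  have h1 : v ≫ h = 0 := by
    obtain ⟨x, hx⟩ := (shiftFunctor K (1 : ℤ)).map_surjective (v ≫ h)
    obtain ⟨r, rfl⟩ := hA.exists_smul x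
    have h2 : (v ≫ h) ≫ (b • 𝟙 A)⟦(1 : ℤ)⟧' = 0 := by
      rw [Category.assoc]
      exact (congrArg (v ≫ ·) (comp_distTriang_mor_zero₃₁ _ hT)).trans comp_zero
    rw [← hx, ← Functor.map_comp, Linear.smul_comp, Category.id_comp, smul_smul] at h2
    have h3 := hA.smul_injective _ ((shiftFunctor K (1 : ℤ)).map_injective
      (h2.trans (Functor.map_zero _ _ _).symm))
    obtain rfl := (mul_eq_zero.1 h3).resolve_right hb
    rw [← hx, zero_smul, Functor.map_zero]
  obtain ⟨x, hx⟩ : ∃ x : A⟦(1 : ℤ)⟧ ⟶ A, v = x ≫ g := Triangle.coyoneda_exact₃ _ hT v h1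
  rw [hx, hA.shift_hom x, zero_comp]

/-- `X` is a retract of the cone `C` of `b` on `Z`, and `C` lies in `J` with `Z`. The section `θ` is
induced by `A ⟶ Z`. The retraction `r` comes from `q : Z ⟶ X`, which extends to `C` because `b`
kills `X`. By `IsRigidUnit.eq_zero`, `θ ≫ r = 𝟙` need only be checked on `A`. -/
lemma IsCone.prop_of_dvd [IsDomain R] {J : ObjectProperty K} (hJ : IsThick J) {b c : R}
    {A X Z : K} (hA : IsRigidUnit R A) (hb : b ≠ 0) (hbc : b ∣ c) (hX : IsCone b A X)
    (hZ : IsCone c A Z) (hJZ : J Z) : J X := by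
  have := hJ.retracts
  obtain ⟨C, hC⟩ := exists_isCone b Z
  have hJC := hC.prop hJ hJZ
  obtain ⟨a, rfl⟩ := hbc
  obtain ⟨i, _, hX⟩ := hX
  obtain ⟨i', _, hZ⟩ := hZ
  obtain ⟨j, _, hC⟩ := hC
  have h0 : ((b * a) • 𝟙 A) ≫ 𝟙 A = (a • 𝟙 A) ≫ (b • 𝟙 A) := by
    simp [smul_smul]
  have h0' : (b • 𝟙 A) ≫ i' = i' ≫ (b • 𝟙 Z) := by simp
  obtain ⟨q, hq⟩ : ∃ q : Z ⟶ X, i' ≫ q = 𝟙 A ≫ i :=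
    have ⟨q, hq, _⟩ := complete_distinguished_triangle_morphism _ _ hZ hX _ _ h0
    ⟨q, hq⟩
  rw [Category.id_comp] at hq
  obtain ⟨θ, hθ⟩ : ∃ θ : X ⟶ C, i ≫ θ = i' ≫ j :=
    have ⟨θ, hθ, _⟩ := complete_distinguished_triangle_morphism _ _ hX hC i' i' h0'
    ⟨θ, hθ⟩
  have h1 : b • 𝟙 X = 0 := hA.eq_zero hb hX (by
    have := comp_distTriang_mor_zero₁₂ _ hX
    change (b • 𝟙 A) ≫ i = 0 at this
    rw [Linear.smul_comp, Category.id_comp] at this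
    rw [Linear.comp_smul, Category.comp_id, this])
  obtain ⟨r, hr⟩ : ∃ r : C ⟶ X, q = j ≫ r := Triangle.yoneda_exact₂ _ hC q (by
    change (b • 𝟙 Z) ≫ q = 0
    rw [Linear.smul_comp, Category.id_comp, ← Category.comp_id q, ← Linear.comp_smul, h1,
      comp_zero])
  have h2 : θ ≫ r - 𝟙 X = 0 := hA.eq_zero hb hX (by
    rw [Preadditive.comp_sub, ← Category.assoc, hθ, Category.assoc, ← hr, hq, Category.comp_id,
      sub_self])
  exact J.prop_of_retract ⟨θ, r, sub_eq_zero.1 h2⟩ hJC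

end Cones

/-! ### Splitting elementary summands off a complex. -/

section Splitting

open CochainComplex CochainComplex.HomComplex

variable {C : Type v} [Category.{w} C] [Preadditive C] [HasZeroObject C]
  {A : C} {E : CochainComplex C ℤ} {i : ℤ}

/-- A direct summand in degree `i` gives a retract of the complex. -/
lemma exists_single_retract (z : A ⟶ E.X i) (f : E.X i ⟶ A) (hz : z ≫ E.d i (i + 1) = 0)
    (hf : E.d (i - 1) i ≫ f = 0) (hzf : z ≫ f = 𝟙 A) :
    ∃ (r : (singleFunctor C i).obj A ⟶ E) (s : E ⟶ (singleFunctor C i).obj A), r ≫ s = 𝟙 _ ∧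
      (s ≫ r).f i = f ≫ z ∧ ∀ n, n ≠ i → (s ≫ r).f n = 0 := by
  let e : ((singleFunctor C i).obj A).X i ≅ A := HomologicalComplex.singleObjXSelf (.up ℤ) i A
  let r := Cocycle.homOf (Cocycle.fromSingleMk z (add_zero i) (i + 1) rfl hz)
  let s := Cocycle.homOf (Cocycle.toSingleMk f (add_zero i) (i - 1) (by omega) hf)
  have hr : r.f i = e.hom ≫ z :=
    Cochain.fromSingleMk_v z (add_zero i)
  have hs : s.f i = f ≫ e.inv :=
    Cochain.toSingleMk_v f (add_zero i)
  have hs' : ∀ n, n ≠ i → s.f n = 0 := fun n hn =>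
    (HomologicalComplex.isZero_single_obj_X (.up ℤ) i A n hn).eq_of_tgt _ _
  refine ⟨r, s, ?_, ?_, fun n hn => ?_⟩
  · ext n
    by_cases hn : n = i
    · subst hn
      rw [HomologicalComplex.comp_f, hr, hs]
      simp [reassoc_of% hzf]
    · exact (HomologicalComplex.isZero_single_obj_X (.up ℤ) i A n hn).eq_of_tgt _ _
  · rw [HomologicalComplex.comp_f, hr, hs]
    simp
  · rw [HomologicalComplex.comp_f, hs' n hn, zero_comp]

variable [HasBinaryBiproducts C]

/-- An embedded copy of `A ⟶ A` in degrees `i - 1` and `i` with compatible coordinate functions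
gives a retract of the complex. -/
lemma exists_mappingCone_retract (a : A ⟶ A) (z : A ⟶ E.X i) (y : A ⟶ E.X (i - 1))
    (f : E.X i ⟶ A) (g : E.X (i - 1) ⟶ A) (hz : z ≫ E.d i (i + 1) = 0)
    (hy : y ≫ E.d (i - 1) i = a ≫ z) (hf : E.d (i - 1) i ≫ f = g ≫ a)
    (hg : E.d (i - 1 - 1) (i - 1) ≫ g = 0) (hzf : z ≫ f = 𝟙 A) (hyg : y ≫ g = 𝟙 A) :
    ∃ (r : mappingCone ((singleFunctor C i).map a) ⟶ E)
      (s : E ⟶ mappingCone ((singleFunctor C i).map a)), r ≫ s = 𝟙 _ ∧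
      (s ≫ r).f i = f ≫ z ∧ (s ≫ r).f (i - 1) = g ≫ y ∧
      ∀ n, n ≠ i → n ≠ i - 1 → (s ≫ r).f n = 0 := by
  let e : ((singleFunctor C i).obj A).X i ≅ A := HomologicalComplex.singleObjXSelf (.up ℤ) i A
  -- The cone has its source copy of `A` in degree `i - 1` and its target copy in degree `i`: `y'`
  -- and `g'` handle the former, `z'` and `f'` the latter.
  let z' := Cocycle.fromSingleMk z (add_zero i) (i + 1) rfl hz
  let y' := Cochain.fromSingleMk y (show i + (-1) = i - 1 by omega)
  let g' := Cocycle.toSingleMk g (show i - 1 + 1 = i by omega) (i - 1 - 1) (by omega) hg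
  let f' := Cochain.toSingleMk f (add_zero i)
  have hr : δ (-1) 0 y' = Cochain.ofHom ((singleFunctor C i).map a ≫ Cocycle.homOf z') := by
    rw [Cochain.δ_fromSingleMk _ _ 0 i (by omega), Cochain.ofHom_comp,
      Cocycle.cochain_ofHom_homOf_eq_coe, hy, Cochain.fromSingleMk_precomp]
    rfl
  have hs : δ 0 1 f' + g'.1.comp (Cochain.ofHom ((singleFunctor C i).map a)) (add_zero 1) = 0 := by
    rw [Cochain.δ_toSingleMk _ _ 1 (i - 1) (by omega), hf, Cochain.toSingleMk_postcomp _ (by omega)]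
    simp only [Int.negOnePow_one, Units.neg_smul, one_smul]
    exact neg_add_cancel _
  let r := mappingCone.desc ((singleFunctor C i).map a) y' (Cocycle.homOf z') hr
  let s := mappingCone.lift ((singleFunctor C i).map a) g' f' hs
  have hv := mappingCone.lift_desc_f ((singleFunctor C i).map a) g' f' hs y' (Cocycle.homOf z') hr
  have hz1 : (Cocycle.homOf z').f i = e.hom ≫ z :=
    Cochain.fromSingleMk_v z (add_zero i)
  have hy1 : y'.v i (i - 1) (by omega) =
      e.hom ≫ y := Cochain.fromSingleMk_v y _
  have hf1 : f'.v i i (add_zero i) = f ≫ e.inv :=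
    Cochain.toSingleMk_v f _
  have hg1 : g'.1.v (i - 1) i (by omega) =
      g ≫ e.inv := Cochain.toSingleMk_v g _
  have hf0 : ∀ n, n ≠ i → f'.v n n (add_zero n) = 0 := fun n hn =>
    Cochain.toSingleMk_v_eq_zero f (add_zero i) _ _ _ hn
  have hg0 : ∀ n m (h : n + 1 = m), n ≠ i - 1 → g'.1.v n m h = 0 := fun n m h hn =>
    Cochain.toSingleMk_v_eq_zero g (show i - 1 + 1 = i by omega) _ _ _ hn
  refine ⟨r, s, ?_, ?_, ?_, fun n hn hn' => ?_⟩
  · ext n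
    rw [HomologicalComplex.comp_f, HomologicalComplex.id_f]
    refine mappingCone.ext_from _ (n + 1) n rfl ?_ ?_
    · rw [mappingCone.inl_v_desc_f_assoc, Category.comp_id]
      refine mappingCone.ext_to _ n (n + 1) rfl ?_ ?_
      · rw [Category.assoc, mappingCone.lift_f_fst_v, mappingCone.inl_v_fst_v]
        by_cases hn : n + 1 = i
        · obtain rfl : n = i - 1 := by omega
          -- The degree `i - 1 + 1` is only propositionally equal to `i`, so the identity is proved
          -- for any `j = i`.
          have key : ∀ j (hj : j = i) (h : j + (-1) = i - 1) (h' : i - 1 + 1 = j),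
              y'.v j (i - 1) h ≫ g'.1.v (i - 1) j h' = 𝟙 _ := by
            rintro _ rfl h h'
            rw [hy1, hg1, Category.assoc, reassoc_of% hyg, e.hom_inv_id]
          exact key _ hn _ _
        · exact (HomologicalComplex.isZero_single_obj_X (.up ℤ) i A _ hn).eq_of_tgt _ _
      · rw [Category.assoc, mappingCone.lift_f_snd_v, mappingCone.inl_v_snd_v]
        by_cases hn : n = i
        · exact (HomologicalComplex.isZero_single_obj_X (.up ℤ) i A (n + 1)
            (by omega)).eq_of_src _ _
        · rw [hf0 n hn, comp_zero]
    · rw [mappingCone.inr_f_desc_f_assoc, Category.comp_id]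
      refine mappingCone.ext_to _ n (n + 1) rfl ?_ ?_
      · rw [Category.assoc, mappingCone.lift_f_fst_v, mappingCone.inr_f_fst_v]
        by_cases hn : n = i
        · rw [hg0 n (n + 1) rfl (by omega), comp_zero]
        · exact (HomologicalComplex.isZero_single_obj_X (.up ℤ) i A n hn).eq_of_src _ _
      · rw [Category.assoc, mappingCone.lift_f_snd_v, mappingCone.inr_f_snd_v]
        by_cases hn : n = i
        · subst hn
          rw [hz1, hf1, Category.assoc, reassoc_of% hzf, e.hom_inv_id]
        · exact (HomologicalComplex.isZero_single_obj_X (.up ℤ) i A _ hn).eq_of_tgt _ _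
  · rw [HomologicalComplex.comp_f, hv i (i + 1) rfl, hz1, hf1, hg0 _ _ _ (by omega)]
    simp
  · rw [HomologicalComplex.comp_f, hv (i - 1) i (by omega), hg1, hy1, hf0 _ (by omega)]
    simp
  · rw [HomologicalComplex.comp_f, hv n (n + 1) rfl, hf0 n hn, hg0 _ _ _ hn']
    simp

end Splitting

noncomputable section

/-! ### Shifts of `R` and cones of scalars as perfect complexes. -/

section FreeObjects

variable (R : Type u) [CommRing R]

/-- The complex `R[-i]`. -/
abbrev freeComplex (i : ℤ) : ModComplex R :=
  (CochainComplex.singleFunctor (ModuleCat.{u} R) i).obj (ModuleCat.of R R)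

lemma isZero_freeComplex_X {i n : ℤ} (h : n ≠ i) : IsZero ((freeComplex R i).X n) :=
  HomologicalComplex.isZero_single_obj_X (.up ℤ) i (ModuleCat.of R R) n h

lemma isStrictlyPerfect_freeComplex (i : ℤ) : IsStrictlyPerfect R (freeComplex R i) := by
  have e : (freeComplex R i).X i ≅ ModuleCat.of R R :=
    HomologicalComplex.singleObjXSelf (ComplexShape.up ℤ) i (ModuleCat.of R R)
  refine ⟨⟨i, i, fun n hn => isZero_freeComplex_X R (by omega)⟩, fun n => ?_, fun n => ?_⟩
  · by_cases hn : n = i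
    · subst hn
      exact Module.Finite.equiv e.symm.toLinearEquiv
    · have := ModuleCat.subsingleton_of_isZero (isZero_freeComplex_X R hn)
      infer_instance
  · by_cases hn : n = i
    · subst hn
      exact Module.Projective.of_equiv e.symm.toLinearEquiv
    · have := ModuleCat.subsingleton_of_isZero (isZero_freeComplex_X R hn)
      infer_instance

/-- The free module of rank one, in degree `i`. -/
def DPerf.freeAt (i : ℤ) : DPerf R :=
  ⟨(KMod.Q R).obj (freeComplex R i), isStrictlyPerfect_freeComplex R i⟩

variable {R}

/-- The multiplication by `a` on `R[-i]`. -/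
abbrev freeComplex.smul (a : R) (i : ℤ) : freeComplex R i ⟶ freeComplex R i :=
  (CochainComplex.singleFunctor (ModuleCat.{u} R) i).map (a • 𝟙 (ModuleCat.of R R))

/-- The cone of the multiplication by `a` on the free module of rank one in degree `i`. -/
def DPerf.coneAt (a : R) (i : ℤ) : DPerf R :=
  ⟨(KMod.Q R).obj (CochainComplex.mappingCone (freeComplex.smul a i)),
    (isStrictlyPerfect_freeComplex R i).mappingCone (isStrictlyPerfect_freeComplex R i) _⟩

lemma freeComplex.smul_eq (a : R) (i : ℤ) : freeComplex.smul a i = a • 𝟙 (freeComplex R i) := by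
  rw [freeComplex.smul, Functor.map_smul, CategoryTheory.Functor.map_id]

lemma isRigidUnit_freeAt (i : ℤ) : IsRigidUnit R (DPerf.freeAt R i) where
  exists_smul f := by
    obtain ⟨g, hg⟩ := KMod.Q_surj f.hom
    obtain ⟨x, rfl⟩ := (CochainComplex.singleFunctor (ModuleCat.{u} R) i).map_surjective g
    refine ⟨x.hom 1, InducedCategory.hom_ext ?_⟩
    have h1 : x = x.hom (1 : R) • 𝟙 (ModuleCat.of R R) := by
      ext
      simp
    have h2 : (KMod.Q R).map (x.hom (1 : R) • 𝟙 (freeComplex R i)) = f.hom := by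
      rw [← freeComplex.smul_eq, ← hg]
      exact congrArg (fun y => (KMod.Q R).map
        ((CochainComplex.singleFunctor (ModuleCat.{u} R) i).map y)) h1.symm
    rw [Functor.map_smul, CategoryTheory.Functor.map_id] at h2
    exact h2.symm
  smul_injective r hr := by
    obtain ⟨h⟩ := (DPerf.smul_id_eq_zero_iff_homotopy _ r).1 hr
    let e : (freeComplex R i).X i ≅ ModuleCat.of R R :=
      HomologicalComplex.singleObjXSelf (ComplexShape.up ℤ) i (ModuleCat.of R R)
    obtain ⟨y, hy⟩ := ModComplex.smul_eq_d_of_homotopy h (i - 1) i (by omega)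
      (e.inv.hom (1 : R)) rfl
    -- The differential of a complex concentrated in one degree is zero, so a null-homotopy of `r`
    -- forces `r • 1 = 0`.
    have h1 : r • e.inv.hom (1 : R) = 0 := hy.symm
    have h2 := congrArg e.hom.hom h1
    rw [map_smul, map_zero] at h2
    have h3 : e.hom.hom (e.inv.hom (1 : R)) = (1 : R) :=
      congr($(congrArg ModuleCat.Hom.hom e.inv_hom_id) (1 : R))
    rw [h3] at h2
    simpa using h2
  shift_hom f := by
    let e := ((perfProp R).ι.commShiftIso (1 : ℤ)).app (DPerf.freeAt R i)
    let e' : (KMod.Q R).obj ((freeComplex R i)⟦(1 : ℤ)⟧) ≅ ((DPerf.freeAt R i)⟦(1 : ℤ)⟧).obj :=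
      ((KMod.Q R).commShiftIso (1 : ℤ)).app (freeComplex R i) ≪≫ e.symm
    let g : (KMod.Q R).obj ((freeComplex R i)⟦(1 : ℤ)⟧) ⟶ (KMod.Q R).obj (freeComplex R i) :=
      e'.hom ≫ f.hom
    obtain ⟨x, hx⟩ := KMod.Q_surj g
    have h0 : x = 0 := by
      ext n : 1
      by_cases hn : n = i
      · exact (isZero_freeComplex_X R (show n + 1 ≠ i by omega)).eq_of_src _ _
      · exact (isZero_freeComplex_X R hn).eq_of_tgt _ _
    have hg : g = 0 := hx.symm.trans ((congrArg (KMod.Q R).map h0).trans (Functor.map_zero _ _ _))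
    have hf : f.hom = e'.inv ≫ g := (e'.inv_hom_id_assoc f.hom).symm
    refine InducedCategory.hom_ext (hf.trans ?_)
    rw [hg]
    exact comp_zero

/-- `R[-i'][n] ≅ R[-i]` if `n + i = i'`. -/
lemma nonempty_shift_freeAt_iso (n i i' : ℤ) (h : n + i = i') :
    Nonempty ((DPerf.freeAt R i')⟦n⟧ ≅ DPerf.freeAt R i) := by
  let e := ((perfProp R).ι.commShiftIso n).app (DPerf.freeAt R i')
  let e' := ((HomotopyCategory.singleFunctors (ModuleCat.{u} R)).shiftIso n i i' h).app
    (ModuleCat.of R R)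
  exact ⟨(perfProp R).ι.preimageIso (e ≪≫ e')⟩

/-- An abstract cone in `DPerf R` becomes, in the ambient homotopy category, isomorphic to the
mapping cone; full faithfulness brings the isomorphism back. -/
lemma isCone_coneAt (a : R) (i : ℤ) : IsCone a (DPerf.freeAt R i) (DPerf.coneAt a i) := by
  obtain ⟨X, hX⟩ := exists_isCone a (DPerf.freeAt R i)
  refine hX.of_iso (Iso.refl _) ?_
  have h := hX
  choose g f hT using h
  have hT' : (perfProp R).ι.mapTriangle.obj (Triangle.mk (a • 𝟙 (DPerf.freeAt R i)) g f) ∈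
      distTriang (KMod R) := (perfProp R).ι.map_distinguished _ hT
  refine (perfProp R).ι.preimageIso (Triangle.π₃.mapIso (isoTriangleOfIso₁₂ _
    (CochainComplex.mappingCone.triangleh (freeComplex.smul a i)) hT'
    (HomotopyCategory.mappingCone_triangleh_distinguished _) (Iso.refl _) (Iso.refl _) ?_))
  have h1 : (KMod.Q R).map (freeComplex.smul a i) = a • 𝟙 _ := by
    rw [freeComplex.smul_eq, Functor.map_smul, CategoryTheory.Functor.map_id]
  exact (Category.comp_id _).trans (h1.symm.trans (Category.id_comp _).symm)

end FreeObjects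

end

/-! ### Smith normal form and the decomposition of perfect complexes. -/

section SmithSplitting

variable {R : Type*} [CommRing R] [IsDomain R] [IsPrincipalIdealRing R]
  {M N : Type*} [AddCommGroup M] [Module R M] [AddCommGroup N] [Module R N]

/-- The Smith normal form of a linear map, with respect to projections `p` onto a submodule that
contains the range and `q` onto the kernel. -/
lemma exists_smith_splitting [Module.Finite R M] [Module.Free R M] (d : N →ₗ[R] M)
    (p : M →ₗ[R] M) (q : N →ₗ[R] N) (hp : ∀ x, p (p x) = p x) (hpd : ∀ x, p (d x) = d x)
    (hdq : ∀ x, d (q x) = 0) (hq : ∀ x, d x = 0 → q x = x) :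
    ∃ (m n : ℕ) (z : Fin m → M) (F : Fin m → M →ₗ[R] R) (y : Fin n → N) (g : Fin n → N →ₗ[R] R)
      (f : Fin n ↪ Fin m) (a : Fin n → R),
      (∀ j, p (z j) = z j) ∧ (∀ j, F j (z j) = 1) ∧ (∀ x, ∑ j, F j x • z j = p x) ∧
      (∀ j, j ∉ Set.range f → ∀ x, F j (d x) = 0) ∧ (∀ k, a k ≠ 0) ∧
      (∀ k, d (y k) = a k • z (f k)) ∧ (∀ k x, F (f k) (d x) = a k * g k x) ∧
      (∀ k x, d x = 0 → g k x = 0) ∧ (∀ k, g k (y k) = 1) ∧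
      ∀ x, ∑ k, g k x • y k = x - q x := by
  let Z := LinearMap.range p
  have hZ : ∀ z : Z, p z = z := by
    rintro ⟨_, x, rfl⟩
    exact hp x
  let p' : M →ₗ[R] Z := p.rangeRestrict
  have hp' : ∀ z : Z, p' z = z := fun z => Subtype.ext (hZ z)
  let d' : N →ₗ[R] Z := d.codRestrict Z fun x => ⟨d x, hpd x⟩
  have hd' : ∀ x, p' (d x) = d' x := fun x => Subtype.ext (hpd x)
  let d'' : N →ₗ[R] LinearMap.range d' := d'.rangeRestrict
  have hd : ∀ x, d'' x = 0 ↔ d x = 0 := fun x => by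
    rw [Subtype.ext_iff, Subtype.ext_iff]
    rfl
  let b := Module.finBasis R Z
  obtain ⟨n, s⟩ := Submodule.smithNormalForm b (LinearMap.range d')
  have hw : ∀ k, ∃ w, d'' w = s.bN k := fun k => d'.surjective_rangeRestrict _
  choose w hw using hw
  -- Subtracting `q (w k)` normalizes the preimages to lie in the complement of the kernel cut out
  -- by `q`.
  have hy : ∀ k, d'' (w k - q (w k)) = s.bN k := fun k => by
    rw [map_sub, (hd _).2 (hdq _), sub_zero, hw]
  have hqq : ∀ x, q (q x) = q x := fun x => hq _ (hdq x)
  have hdy : ∀ k, d' (w k - q (w k)) = s.a k • s.bM (s.f k) := fun k =>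
    (congrArg Subtype.val (hy k)).trans (s.snf k)
  refine ⟨_, n, fun j => s.bM j, fun j => s.bM.coord j ∘ₗ p', fun k => w k - q (w k),
    fun k => s.bN.coord k ∘ₗ d'', s.f, s.a, fun j => hZ _, fun j => ?_, fun x => ?_,
    fun j hj x => ?_, fun k hk => ?_, fun k => ?_, fun k x => ?_, fun k x hx => ?_, fun k => ?_,
    fun x => ?_⟩
  · simp [hp']
  · have := congrArg (Submodule.subtype Z) (s.bM.sum_repr (p' x))
    rw [map_sum] at this
    refine Eq.trans ?_ (show (p' x : M) = p x from rfl)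
    simpa using this
  · have := s.repr_eq_zero_of_notMem_range (d'' x) hj
    exact (congrArg (s.bM.coord j) (hd' x)).trans this
  · have := s.snf k
    rw [hk, zero_smul] at this
    exact s.bN.ne_zero k (Subtype.ext this)
  · exact congrArg Subtype.val (hdy k)
  · have := s.repr_apply_embedding_eq_repr_smul (m := d'' x) (i := k)
    exact (congrArg (s.bM.coord (s.f k)) (hd' x)).trans (this.trans (by simp))
  · simp [(hd x).2 hx]
  · simp [hy]
  -- The difference is in the kernel of `d`, so `q` fixes it; but `q` also kills each of its terms,
  -- so it is zero.
  · have h1 : d'' (∑ k, (s.bN.coord k ∘ₗ d'') x • (w k - q (w k)) - (x - q x)) = 0 := by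
      rw [map_sub, map_sub, (hd _).2 (hdq x), map_sum]
      simp only [map_smul, hy]
      simp [s.bN.sum_repr]
    have h2 := hq _ ((hd _).1 h1)
    rw [map_sub, map_sub, hqq, sub_self, sub_zero, map_sum] at h2
    simp only [map_smul, map_sub, hqq, sub_self, smul_zero, Finset.sum_const_zero] at h2
    exact (sub_eq_zero.1 h2.symm)

end SmithSplitting

section Decomposition

variable {R : Type u} [CommRing R]

/-- The complexes `R[-i]` and the cones of nonzero scalars on them. -/
def IsElementaryComplex (X : ModComplex R) : Prop :=
  ∃ i, X = freeComplex R i ∨ ∃ a ≠ 0, X = CochainComplex.mappingCone (freeComplex.smul a i)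

/-- The idempotent endomorphisms of `E` with elementary image. -/
def elementaryEnd (E : ModComplex R) : Set (E ⟶ E) :=
  {c | ∃ X, IsElementaryComplex X ∧ ∃ (r : X ⟶ E) (s : E ⟶ X), r ≫ s = 𝟙 X ∧ s ≫ r = c}

lemma ModComplex.sum_f {ι : Type*} {E F : ModComplex R} (s : Finset ι) (c : ι → (E ⟶ F)) (n : ℤ) :
    (∑ j ∈ s, c j).f n = ∑ j ∈ s, (c j).f n :=
  (HomologicalComplex.eval _ _ n).map_sum c s

variable [IsDomain R] [IsPrincipalIdealRing R] {E : ModComplex R}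

/-- The map `c` projects onto the two-term subcomplex formed by a complement of the cocycles in
degree `i - 1` and the cocycles in degree `i`. Smith normal form diagonalizes its differential:
nonzero diagonal entries give cones, the remaining basis vectors give copies of `R[-i]`. -/
lemma exists_mem_closure_elementaryEnd (hE : IsStrictlyPerfect R E)
    (p : ∀ i, E.X i →ₗ[R] E.X i) (hp : ∀ i j x, (E.d i j).hom (p i x) = 0)
    (hp' : ∀ i x, (E.d i (i + 1)).hom x = 0 → p i x = x) (i : ℤ) :
    ∃ c ∈ AddSubmonoid.closure (elementaryEnd E), (∀ x, (c.f i).hom x = p i x) ∧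
      (∀ x, (c.f (i - 1)).hom x = x - p (i - 1) x) ∧
      ∀ n, n ≠ i → n ≠ i - 1 → c.f n = 0 := by
  have := hE.finite i
  have := hE.projective i
  have hp'' : ∀ i j (hij : i + 1 = j) x, (E.d i j).hom x = 0 → p i x = x := by
    rintro i _ rfl
    exact hp' i
  have hdd : ∀ i j k x, (E.d j k).hom ((E.d i j).hom x) = 0 := fun i j k x =>
    congr($(congrArg ModuleCat.Hom.hom (E.d_comp_d i j k)) x)
  obtain ⟨m, n, z, F, y, g, f, a, hz, hFz, hF, hFd, ha, hdy, hFf, hg, hgy, hgs⟩ :=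
    exists_smith_splitting (E.d (i - 1) i).hom (p i) (p (i - 1))
      (fun x => hp' i _ (hp i _ x)) (fun x => hp' i _ (hdd _ _ _ x))
      (fun x => hp (i - 1) i x) (hp'' (i - 1) i (by omega))
  have hdz : ∀ j, (E.d i (i + 1)).hom (z j) = 0 := fun j => by rw [← hz j, hp]
  let zz : ∀ j, ModuleCat.of R R ⟶ E.X i := fun j =>
    ModuleCat.ofHom (LinearMap.toSpanSingleton R _ (z j))
  let FF : ∀ j, E.X i ⟶ ModuleCat.of R R := fun j => ModuleCat.ofHom (F j)
  let yy : ∀ k, ModuleCat.of R R ⟶ E.X (i - 1) := fun k =>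
    ModuleCat.ofHom (LinearMap.toSpanSingleton R _ (y k))
  let gg : ∀ k, E.X (i - 1) ⟶ ModuleCat.of R R := fun k => ModuleCat.ofHom (g k)
  have h1 : ∀ j, zz j ≫ E.d i (i + 1) = 0 := fun j => by
    ext
    simpa [zz] using hdz j
  have h2 : ∀ j, zz j ≫ FF j = 𝟙 _ := fun j => by
    ext
    simpa [zz, FF] using hFz j
  let G : Fin n → (E.X (i - 1) ⟶ E.X (i - 1)) := fun k => gg k ≫ yy k
  -- Basis cocycles outside the range of `f` have no partner in degree `i - 1`, hence the extension
  -- by zero.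
  let G' : Fin m → (E.X (i - 1) ⟶ E.X (i - 1)) := Function.extend f G fun _ => 0
  have hG : ∀ k, G' (f k) = G k := fun k => f.injective.extend_apply _ _ k
  have hG' : ∀ j, j ∉ Set.range f → G' j = 0 := fun j hj => Function.extend_apply' _ _ _ hj
  have key : ∀ j, ∃ c ∈ elementaryEnd E, c.f i = FF j ≫ zz j ∧
      c.f (i - 1) = G' j ∧
      ∀ n, n ≠ i → n ≠ i - 1 → c.f n = 0 := by
    intro j
    by_cases hj : j ∈ Set.range f
    · obtain ⟨k, rfl⟩ := hj
      obtain ⟨r, s, hrs, hc, hc', hc''⟩ := exists_mappingCone_retract (a k • 𝟙 _) (zz (f k))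
        (yy k) (FF (f k)) (gg k) (h1 _)
        (by ext; simpa [zz, yy] using hdy k) (by ext x; simpa [FF, gg] using hFf k x)
        (by ext x; exact hg k _ (hdd _ _ _ x)) (h2 _) (by ext; simpa [gg, yy] using hgy k)
      exact ⟨_, ⟨_, ⟨i, Or.inr ⟨a k, ha k, rfl⟩⟩, r, s, hrs, rfl⟩, hc,
        hc'.trans (hG k).symm, hc''⟩
    · obtain ⟨r, s, hrs, hc, hc'⟩ := exists_single_retract (zz j) (FF j) (h1 j)
        (by ext x; exact hFd j hj x) (h2 j)
      exact ⟨_, ⟨_, ⟨i, Or.inl rfl⟩, r, s, hrs, rfl⟩, hc,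
        (hc' _ (by omega)).trans (hG' j hj).symm, fun n hn _ => hc' n hn⟩
  choose c hc hc1 hc2 hc3 using key
  refine ⟨∑ j, c j, AddSubmonoid.sum_mem _ fun j _ => AddSubmonoid.subset_closure (hc j),
    fun x => ?_, fun x => ?_, fun n hn hn' => ?_⟩
  · have h3 : (∑ j, c j).f i = ∑ j, FF j ≫ zz j :=
      (ModComplex.sum_f _ _ _).trans (Finset.sum_congr rfl fun j _ => hc1 j)
    rw [h3, ModuleCat.hom_sum, LinearMap.sum_apply]
    exact hF x
  · have h3 : (∑ j, c j).f (i - 1) = ∑ k, gg k ≫ yy k :=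
      ((ModComplex.sum_f _ _ _).trans (Finset.sum_congr rfl fun j _ => hc2 j)).trans
        (Fintype.sum_of_injective f f.injective G G' hG' fun k => (hG k).symm).symm
    rw [h3, ModuleCat.hom_sum, LinearMap.sum_apply]
    exact hgs x
  · exact (ModComplex.sum_f _ _ _).trans (Finset.sum_eq_zero fun j _ => hc3 j n hn hn')

lemma id_mem_closure_elementaryEnd (hE : IsStrictlyPerfect R E) :
    𝟙 E ∈ AddSubmonoid.closure (elementaryEnd E) := by
  obtain ⟨p, hp, hp'⟩ := hE.exists_cocycle_projection
  choose c hc hc1 hc2 hc3 using exists_mem_closure_elementaryEnd hE p hp hp'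
  obtain ⟨a, b, hab⟩ := hE.bounded
  -- In degree `n` the identity is `p` from `c n` plus `1 - p` from `c (n + 1)`, so the sum has to
  -- run up to `b + 1`.
  have h : 𝟙 E = ∑ i ∈ Finset.Icc a (b + 1), c i := by
    ext n : 1
    by_cases hn : n < a ∨ b < n
    · exact (hab n hn).eq_of_tgt _ _
    · rw [HomologicalComplex.id_f]
      refine Eq.symm ((ModComplex.sum_f _ _ _).trans ?_)
      have h1 : ∀ i ∈ Finset.Icc a (b + 1), i ∉ ({n, n + 1} : Finset ℤ) → (c i).f n = 0 :=
        fun i _ hi => by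
          simp only [Finset.mem_insert, Finset.mem_singleton, not_or] at hi
          exact hc3 i n (by omega) (by omega)
      rw [← Finset.sum_subset (fun i hi => by
        simp only [Finset.mem_insert, Finset.mem_singleton] at hi
        rw [Finset.mem_Icc]
        omega) h1, Finset.sum_pair (by omega)]
      ext x
      have h2 : ∀ m (hm : m = n) (x : E.X m), ((c (n + 1)).f m).hom x = x - p m x := by
        intro m hm x
        obtain rfl : m = n + 1 - 1 := by omega
        exact hc2 (n + 1) x
      rw [ModuleCat.hom_add, LinearMap.add_apply, hc1, h2 n rfl, add_sub_cancel]
      rfl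
  rw [h]
  exact AddSubmonoid.sum_mem _ fun i _ => hc i

end Decomposition

section Elementary

variable {R : Type u} [CommRing R]

/-- The objects `R[-i]` and the cones of nonzero scalars on them. -/
def DPerf.IsElementary (X : DPerf R) : Prop :=
  ∃ i, X = DPerf.freeAt R i ∨ ∃ a ≠ 0, X = DPerf.coneAt a i

/-- Endomorphisms that factor through objects of `J` are closed under sums, by way of biproducts.
Applied to the identity, this makes `E` a retract of an object of `J`. -/
lemma exists_factor_of_mem_closure {J : ObjectProperty (DPerf R)} (hJ : IsThick J) {E : DPerf R}
    (h : ∀ X, X.IsElementary → Retract X E → J X) {c : E.cpx ⟶ E.cpx}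
    (hc : c ∈ AddSubmonoid.closure (elementaryEnd E.cpx)) :
    ∃ Y, J Y ∧ ∃ (f : E ⟶ Y) (g : Y ⟶ E), (f ≫ g).hom = (KMod.Q R).map c := by
  have := hJ.triangulated
  have := hJ.retracts
  induction hc using AddSubmonoid.closure_induction with
  | mem c hc =>
    obtain ⟨X, hX, r, s, hrs, hc⟩ := hc
    obtain ⟨Y, hY, hYX⟩ : ∃ Y : DPerf R, Y.IsElementary ∧ Y.obj = (KMod.Q R).obj X := by
      obtain ⟨i, rfl | ⟨a, ha, rfl⟩⟩ := hX
      · exact ⟨_, ⟨i, Or.inl rfl⟩, rfl⟩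
      · exact ⟨_, ⟨i, Or.inr ⟨a, ha, rfl⟩⟩, rfl⟩
    obtain ⟨Y, hpY⟩ := Y
    change Y = _ at hYX
    subst hYX
    let ρ : (⟨(KMod.Q R).obj X, hpY⟩ : DPerf R) ⟶ E := ObjectProperty.homMk ((KMod.Q R).map r)
    let σ : E ⟶ (⟨(KMod.Q R).obj X, hpY⟩ : DPerf R) := ObjectProperty.homMk ((KMod.Q R).map s)
    have h1 : ρ ≫ σ = 𝟙 _ := InducedCategory.hom_ext
      (((KMod.Q R).map_comp r s).symm.trans
        ((congrArg (KMod.Q R).map hrs).trans ((KMod.Q R).map_id X)))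
    exact ⟨_, h _ hY ⟨ρ, σ, h1⟩, σ, ρ,
      ((KMod.Q R).map_comp s r).symm.trans (congrArg (KMod.Q R).map hc)⟩
  | zero =>
    refine ⟨0, J.prop_zero, 0, 0, ?_⟩
    rw [comp_zero]
    exact ((KMod.Q R).map_zero _ _).symm
  | add c d _ _ hc hd =>
    obtain ⟨Y, hY, f, g, hfg⟩ := hc
    obtain ⟨Y', hY', f', g', hfg'⟩ := hd
    refine ⟨Y ⊞ Y', J.ext_of_isTriangulatedClosed₂ _
      (binaryBiproductTriangle_distinguished Y Y') hY hY', biprod.lift f f', biprod.desc g g', ?_⟩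
    rw [biprod.lift_desc]
    exact (congrArg₂ (· + ·) hfg hfg').trans ((KMod.Q R).map_add).symm

variable [IsDomain R] [IsPrincipalIdealRing R]

lemma IsThick.prop_of_isElementary {J : ObjectProperty (DPerf R)} (hJ : IsThick J) {E : DPerf R}
    (h : ∀ X, X.IsElementary → Retract X E → J X) : J E := by
  have := hJ.retracts
  obtain ⟨Y, hY, f, g, hfg⟩ :=
    exists_factor_of_mem_closure hJ h (id_mem_closure_elementaryEnd E.property)
  exact J.prop_of_retract ⟨f, g, InducedCategory.hom_ext (hfg.trans ((KMod.Q R).map_id _))⟩ hY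

end Elementary

/-! ### Perfect complexes that represent `R ⧸ 𝔭`, and their supports. -/

section Residue

variable {R : Type u} [CommRing R]

lemma residueObjects_freeAt {𝔭 : PrimeSpectrum R} (h : 𝔭.asIdeal = ⊥) :
    residueObjects 𝔭 (DPerf.freeAt R 0) := by
  let e : ModuleCat.of R R ≅ ModuleCat.of R (R ⧸ 𝔭.asIdeal) :=
    ((Submodule.quotEquivOfEqBot 𝔭.asIdeal h).symm).toModuleIso
  let e' : (DPerf.freeAt R 0).cpx ≅ (HomologicalComplex.single (ModuleCat.{u} R)
      (ComplexShape.up ℤ) 0).obj (ModuleCat.of R (R ⧸ 𝔭.asIdeal)) :=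
    (HomologicalComplex.single (ModuleCat.{u} R) (ComplexShape.up ℤ) 0).mapIso e
  exact ⟨e'.hom, inferInstance⟩

lemma residueObjects_coneAt [IsDomain R] {𝔭 : PrimeSpectrum R} {a : R} (ha : a ≠ 0)
    (h : 𝔭.asIdeal = Ideal.span {a}) : residueObjects 𝔭 (DPerf.coneAt a 0) := by
  have hw : (a • 𝟙 (ModuleCat.of R R)) ≫ ModuleCat.ofHom 𝔭.asIdeal.mkQ = 0 := by
    ext
    refine Ideal.Quotient.eq_zero_iff_mem.2 (h ▸ Ideal.mem_span_singleton'.2 ⟨1, ?_⟩)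
    exact mul_comm 1 a
  let S : ShortComplex (ModuleCat.{u} R) := ShortComplex.mk _ _ hw
  have hS : S.ShortExact := by
    have h1 : S.Exact := by
      rw [ShortComplex.moduleCat_exact_iff]
      intro x hx
      have hx' : x ∈ Ideal.span {a} := h ▸ Ideal.Quotient.eq_zero_iff_mem.1 hx
      obtain ⟨y, rfl⟩ := Ideal.mem_span_singleton'.1 hx'
      exact ⟨y, mul_comm a y⟩
    have h2 : Mono S.f := by
      rw [ModuleCat.mono_iff_injective]
      exact fun x y hxy => mul_left_cancel₀ ha hxy
    have h3 : Epi S.g := by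
      rw [ModuleCat.epi_iff_surjective]
      exact Submodule.mkQ_surjective _
    exact ⟨h1⟩
  have hS' := hS.map_of_exact (HomologicalComplex.single (ModuleCat.{u} R) (ComplexShape.up ℤ) 0)
  -- The cone of an injective map is quasi-isomorphic to its cokernel.
  exact ⟨_, CochainComplex.mappingCone.quasiIso_descShortComplex hS'⟩

/-- The cohomology is `R ⧸ 𝔭` in degree `0`, with support the closed set of primes above `𝔭`. -/
lemma primeOf_residue_iff {𝔭 𝔮 : PrimeSpectrum R} {E : DPerf R} (hE : residueObjects 𝔭 E) :
    primeOf 𝔮 E ↔ ¬ 𝔭 ≤ 𝔮 := by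
  obtain ⟨f, hf⟩ := hE
  let S := (HomologicalComplex.single (ModuleCat.{u} R) (ComplexShape.up ℤ) 0).obj
    (ModuleCat.of R (R ⧸ 𝔭.asIdeal))
  let e : ∀ i, E.cpx.homology i ≅ S.homology i := fun i =>
    asIso (HomologicalComplex.homologyMap f i)
  have h0 : Module.support R (E.cpx.homology 0) = PrimeSpectrum.zeroLocus 𝔭.asIdeal := by
    let e0 : E.cpx.homology 0 ≅ ModuleCat.of R (R ⧸ 𝔭.asIdeal) := e 0 ≪≫
      HomologicalComplex.singleObjHomologySelfIso (ComplexShape.up ℤ) 0 _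
    rw [LinearEquiv.support_eq e0.toLinearEquiv]
    exact (Module.support_eq_zeroLocus (M := R ⧸ 𝔭.asIdeal)).trans
      (by rw [Ideal.annihilator_quotient])
  have h1 : ∀ i, i ≠ 0 → Subsingleton (E.cpx.homology i) := fun i hi =>
    ModuleCat.subsingleton_of_isZero
      ((HomologicalComplex.isZero_single_obj_homology _ _ _ i hi).of_iso (e i))
  have h2 : Subsingleton (LocalizedModule 𝔮.asIdeal.primeCompl (E.cpx.homology 0)) ↔ ¬ 𝔭 ≤ 𝔮 := by
    rw [← Module.notMem_support_iff, h0]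
    rfl
  rw [← h2]
  refine ⟨fun h => h 0, fun h i => ?_⟩
  by_cases hi : i = 0
  · exact hi ▸ h
  · have := h1 i hi
    exact LocalizedModule.subsingleton_iff.2 fun m => ⟨1, one_mem _, Subsingleton.elim _ _⟩

end Residue

/-! ### Thick subcategories are determined by supports. -/

section Classification

variable {R : Type u} [CommRing R]

lemma IsThick.prop_freeAt {J : ObjectProperty (DPerf R)} (hJ : IsThick J) {i : ℤ}
    (h : J (DPerf.freeAt R i)) (j : ℤ) : J (DPerf.freeAt R j) := by
  obtain ⟨e⟩ := nonempty_shift_freeAt_iso (R := R) (i - j) j i (by omega)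
  exact hJ.prop_of_iso e (hJ.prop_shift h _)

lemma PrimeSpectrum.exists_span_singleton [IsPrincipalIdealRing R] (𝔭 : PrimeSpectrum R) :
    ∃ a, 𝔭.asIdeal = Ideal.span {a} :=
  (IsPrincipalIdealRing.principal 𝔭.asIdeal).principal

variable [IsDomain R]

lemma IsThick.prop_coneAt {J : ObjectProperty (DPerf R)} (hJ : IsThick J) {b c : R} (hb : b ≠ 0)
    (hbc : b ∣ c) {i : ℤ} (h : J (DPerf.coneAt c i)) (j : ℤ) : J (DPerf.coneAt b j) := by
  obtain ⟨e⟩ := nonempty_shift_freeAt_iso (R := R) (i - j) j i (by omega)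
  exact IsCone.prop_of_dvd hJ (isRigidUnit_freeAt j) hb hbc (isCone_coneAt b j)
    (((isCone_coneAt c i).shift (i - j)).of_iso e (Iso.refl _)) (hJ.prop_shift h _)

/-- In a general triangulated category `a` need not act as zero on its cone; rigidity of `R[-i]`
ensures it here. -/
lemma smul_id_coneAt {a : R} (ha : a ≠ 0) (i : ℤ) : a • 𝟙 (DPerf.coneAt a i) = 0 := by
  obtain ⟨g, f, hT⟩ := isCone_coneAt a i
  refine (isRigidUnit_freeAt i).eq_zero ha hT ?_
  have h : (a • 𝟙 (DPerf.freeAt R i)) ≫ g = 0 := comp_distTriang_mor_zero₁₂ _ hT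
  rw [Linear.smul_comp, Category.id_comp] at h
  rw [Linear.comp_smul, Category.comp_id, h]

variable [IsPrincipalIdealRing R]

lemma not_primeOf_freeAt (𝔭 : PrimeSpectrum R) (i : ℤ) : ¬ primeOf 𝔭 (DPerf.freeAt R i) := by
  rw [primeOf_iff]
  rintro ⟨s, hs, h⟩
  exact hs ((isRigidUnit_freeAt i).smul_injective s h ▸ zero_mem _)

/-- A generator `a` of `𝔭` divides `c`, so the thick subcategory `P(𝔭)` would contain the cone of
`a`, which represents `R ⧸ 𝔭`. -/
lemma not_primeOf_coneAt (𝔭 : PrimeSpectrum R) {c : R} (hc : c ≠ 0) (h : c ∈ 𝔭.asIdeal) (i : ℤ) :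
    ¬ primeOf 𝔭 (DPerf.coneAt c i) := fun hp => by
  obtain ⟨a, ha⟩ := 𝔭.exists_span_singleton
  have hac : a ∣ c := Ideal.mem_span_singleton.1 (ha ▸ h)
  have ha0 : a ≠ 0 := ne_zero_of_dvd_ne_zero hc hac
  exact (primeOf_residue_iff (residueObjects_coneAt ha0 ha)).1
    ((isThick_primeOf 𝔭).prop_coneAt ha0 hac hp 0) le_rfl

lemma exists_isElementary_not_primeOf {𝔭 : PrimeSpectrum R} {E : DPerf R} (h : ¬ primeOf 𝔭 E) :
    ∃ X, X.IsElementary ∧ Nonempty (Retract X E) ∧ ¬ primeOf 𝔭 X := by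
  by_contra! hc
  exact h ((isThick_primeOf 𝔭).prop_of_isElementary fun X hX r => hc X hX ⟨r⟩)

/-- Cones of nonzero scalars are torsion, so an object that is nonzero at the generic point has some
`R[-i]` as a retract. -/
lemma IsThick.prop_freeAt_of_not_primeOf {J : ObjectProperty (DPerf R)} (hJ : IsThick J)
    {𝔭 : PrimeSpectrum R} (h𝔭 : 𝔭.asIdeal = ⊥) {E : DPerf R}
    (hE : J E) (h : ¬ primeOf 𝔭 E) (j : ℤ) : J (DPerf.freeAt R j) := by
  have := hJ.retracts
  obtain ⟨_, ⟨i, rfl | ⟨a, ha, rfl⟩⟩, ⟨r⟩, h⟩ := exists_isElementary_not_primeOf h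
  · exact hJ.prop_freeAt (J.prop_of_retract r hE) j
  · refine (h (primeOf_of_smul_eq_zero (s := a) ?_ (smul_id_coneAt ha i))).elim
    rwa [h𝔭]

/-- Some elementary retract of `E` is nonzero at `𝔭`: it is free, or a cone of some `a ∈ 𝔭`, in
which case `b ∣ a`. -/
lemma IsThick.prop_coneAt_of_not_primeOf {J : ObjectProperty (DPerf R)} (hJ : IsThick J)
    {𝔭 : PrimeSpectrum R} {b : R} (hb : b ≠ 0)
    (h𝔭 : 𝔭.asIdeal = Ideal.span {b}) {E : DPerf R} (hE : J E) (h : ¬ primeOf 𝔭 E) (j : ℤ) :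
    J (DPerf.coneAt b j) := by
  have := hJ.retracts
  obtain ⟨_, ⟨i, rfl | ⟨a, ha, rfl⟩⟩, ⟨r⟩, h⟩ := exists_isElementary_not_primeOf h
  · exact (isCone_coneAt b j).prop hJ (hJ.prop_freeAt (J.prop_of_retract r hE) j)
  · refine hJ.prop_coneAt hb ?_ (J.prop_of_retract r hE) j
    rw [← Ideal.mem_span_singleton, ← h𝔭]
    by_contra hc
    exact h (primeOf_of_smul_eq_zero hc (smul_id_coneAt ha i))

lemma IsThick.exists_residueObjects {J : ObjectProperty (DPerf R)} (hJ : IsThick J)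
    {𝔭 : PrimeSpectrum R} {E : DPerf R} (hE : J E)
    (h : ¬ primeOf 𝔭 E) : ∃ X, residueObjects 𝔭 X ∧ J X := by
  obtain ⟨b, hb⟩ := 𝔭.exists_span_singleton
  by_cases hb0 : b = 0
  · have h𝔭 : 𝔭.asIdeal = ⊥ := by rw [hb, hb0, Ideal.span_singleton_eq_bot]
    exact ⟨_, residueObjects_freeAt h𝔭, hJ.prop_freeAt_of_not_primeOf h𝔭 hE h 0⟩
  · exact ⟨_, residueObjects_coneAt hb0 hb, hJ.prop_coneAt_of_not_primeOf hb0 hb hE h 0⟩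

lemma IsThick.prop_coneAt_of_forall_prime {J : ObjectProperty (DPerf R)} (hJ : IsThick J)
    (i : ℤ) (a : R) (ha : a ≠ 0)
    (h : ∀ 𝔭 : PrimeSpectrum R, a ∈ 𝔭.asIdeal → ∃ E, J E ∧ ¬ primeOf 𝔭 E) :
    J (DPerf.coneAt a i) := by
  induction a using UniqueFactorizationMonoid.induction_on_prime with
  | h₁ => exact (ha rfl).elim
  | h₂ a hu => exact hJ.prop_of_isZero ((isCone_coneAt a i).isZero_of_isUnit hu)
  | h₃ a p ha0 hp ih =>
    obtain ⟨E, hE, hE'⟩ := h ⟨Ideal.span {p}, (Ideal.span_singleton_prime hp.ne_zero).2 hp⟩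
      (Ideal.mem_span_singleton.2 (dvd_mul_right p a))
    exact IsCone.prop_mul hJ (isCone_coneAt p i) (isCone_coneAt a i) (isCone_coneAt (p * a) i)
      (hJ.prop_coneAt_of_not_primeOf hp.ne_zero rfl hE hE' i)
      (ih ha0 fun 𝔭 h𝔭 => h 𝔭 (Ideal.mul_mem_left _ _ h𝔭))

/-- Elementary retracts of `E` have smaller support, which reduces to `R[-i]`, settled at the
generic point, and to cones, settled one prime factor at a time. Neither the tensor nor the radical
condition is needed. -/
lemma IsThick.prop_of_forall_primeOf {J : ObjectProperty (DPerf R)} (hJ : IsThick J)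
    {E : DPerf R}
    (h : ∀ 𝔭 : PrimeSpectrum R, ¬ primeOf 𝔭 E → ∃ X, J X ∧ ¬ primeOf 𝔭 X) : J E := by
  refine hJ.prop_of_isElementary fun X hX r => ?_
  have hr : ∀ 𝔭 : PrimeSpectrum R, ¬ primeOf 𝔭 X → ∃ Y, J Y ∧ ¬ primeOf 𝔭 Y := fun 𝔭 hp =>
    h 𝔭 fun hE => hp ((isThick_primeOf 𝔭).retracts.of_retract r hE)
  obtain ⟨i, rfl | ⟨a, ha, rfl⟩⟩ := hX
  · obtain ⟨Y, hY, hY'⟩ := hr ⊥ (not_primeOf_freeAt ⊥ i)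
    exact hJ.prop_freeAt_of_not_primeOf rfl hY hY' i
  · exact hJ.prop_coneAt_of_forall_prime i a ha fun 𝔭 h𝔭 => hr 𝔭 (not_primeOf_coneAt 𝔭 ha h𝔭 i)

end Classification

/-! ### The lattice isomorphism and the homeomorphism. -/

noncomputable section

section OrderIso

variable {R : Type u} [CommRing R] [IsDomain R] [IsPrincipalIdealRing R]

lemma isPrimeTensorIdeal_primeOf (𝔭 : PrimeSpectrum R) : IsPrimeTensorIdeal (primeOf 𝔭) where
  toIsThickTensorIdeal := isThickTensorIdeal_primeOf 𝔭
  proper h := not_primeOf_freeAt 𝔭 0 (h ▸ trivial)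
  mem_or_mem := primeOf_mem_or_mem 𝔭

/-- A prime thick tensor-ideal is radical. -/
def IsPrimeTensorIdeal.toRadicalTensorIdeal {K : Type v} [Category.{w} K] [HasZeroObject K]
    [Preadditive K] [HasShift K ℤ] [∀ n : ℤ, (shiftFunctor K n).Additive] [Pretriangulated K]
    [MonoidalCategory K] {J : ObjectProperty K} (hJ : IsPrimeTensorIdeal J) :
    RadicalTensorIdeal K where
  mem := J
  isThickTensorIdeal := hJ.toIsThickTensorIdeal
  radical X n h := by
    induction n with
    -- The zeroth power is the unit, and an ideal that contains the unit contains `X ≅ X ⊗ 𝟙_`.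
    | zero => exact hJ.toIsThick.prop_of_iso (ρ_ X) (hJ.tensor _ _ h)
    | succ n ih => exact (hJ.mem_or_mem _ _ h).elim ih id

/-- The radical thick tensor-ideal `P(𝔭)`. -/
def primeIdeal (𝔭 : PrimeSpectrum R) : RadicalTensorIdeal (DPerf R) :=
  (isPrimeTensorIdeal_primeOf 𝔭).toRadicalTensorIdeal

lemma RadicalTensorIdeal.exists_residueObjects_iff (J : RadicalTensorIdeal (DPerf R))
    (𝔭 : PrimeSpectrum R) :
    (∃ E, residueObjects 𝔭 E ∧ J.mem E) ↔ ∃ E, J.mem E ∧ ¬ primeOf 𝔭 E :=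
  ⟨fun ⟨E, hE, hJ⟩ => ⟨E, hJ, fun h => (primeOf_residue_iff hE).1 h le_rfl⟩,
    fun ⟨_, hE, h⟩ => J.isThickTensorIdeal.toIsThick.exists_residueObjects hE h⟩

lemma RadicalTensorIdeal.mem_iff (J : RadicalTensorIdeal (DPerf R)) {E : DPerf R} :
    J.mem E ↔ ∀ 𝔭 : PrimeSpectrum R, ¬ primeOf 𝔭 E → ∃ X, residueObjects 𝔭 X ∧ J.mem X := by
  simp only [J.exists_residueObjects_iff]
  exact ⟨fun h 𝔭 hE => ⟨E, h, hE⟩, J.isThickTensorIdeal.toIsThick.prop_of_forall_primeOf⟩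

lemma exists_residueObjects (𝔭 : PrimeSpectrum R) : ∃ E, residueObjects 𝔭 E := by
  obtain ⟨E, hE, -⟩ := ((⊤ : RadicalTensorIdeal (DPerf R)).exists_residueObjects_iff 𝔭).2
    -- The top ideal is the empty intersection, so membership in it is vacuous.
    ⟨DPerf.freeAt R 0, fun J hJ => hJ.elim, not_primeOf_freeAt 𝔭 0⟩
  exact ⟨E, hE⟩

/-- The Thomason subset `φ(J)` of the primes whose residue objects belong to `J`. -/
def supportThom (J : RadicalTensorIdeal (DPerf R)) : Thom (PrimeSpectrum R) :=
  Thom.ofStable {𝔭 | ∃ E, residueObjects 𝔭 E ∧ J.mem E} <| by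
    rintro 𝔭 ⟨E, hE, hJ⟩ 𝔮 h
    refine (J.exists_residueObjects_iff 𝔮).2 ⟨E, hJ, fun h' => (primeOf_residue_iff hE).1 h' ?_⟩
    exact (PrimeSpectrum.le_iff_mem_closure _ _).2 h

lemma mem_supportThom {J : RadicalTensorIdeal (DPerf R)} {𝔭 : PrimeSpectrum R} :
    𝔭 ∈ (supportThom J).carrier ↔ ∃ E, residueObjects 𝔭 E ∧ J.mem E := Iff.rfl

/-- The ideal `ψ(V)` of the objects supported on `V`. -/
def idealOfThom (V : Thom (PrimeSpectrum R)) : RadicalTensorIdeal (DPerf R) :=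
  sInf (primeIdeal '' V.carrierᶜ)

lemma mem_idealOfThom {V : Thom (PrimeSpectrum R)} {E : DPerf R} :
    (idealOfThom V).mem E ↔ ∀ 𝔭, ¬ primeOf 𝔭 E → 𝔭 ∈ V.carrier := by
  refine ⟨fun h 𝔭 => not_imp_comm.1 fun h𝔭 => h _ ⟨𝔭, h𝔭, rfl⟩, ?_⟩
  rintro h _ ⟨𝔭, h𝔭, rfl⟩
  exact not_imp_comm.1 (h 𝔭) h𝔭

lemma mem_idealOfThom_of_residueObjects {V : Thom (PrimeSpectrum R)} {𝔭 : PrimeSpectrum R}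
    (h𝔭 : 𝔭 ∈ V.carrier) {E : DPerf R} (hE : residueObjects 𝔭 E) : (idealOfThom V).mem E := by
  refine mem_idealOfThom.2 fun 𝔮 h => V.closure_subset h𝔭 ?_
  rw [primeOf_residue_iff hE, not_not] at h
  exact (PrimeSpectrum.le_iff_mem_closure _ _).1 h

/-- Defining the ideal as an intersection of the `P(𝔭)` makes it radical and tensor-closed for free;
the classification identifies it with the thick closure. -/
lemma idealOfThom_mem_eq_thickClosure (V : Thom (PrimeSpectrum R)) :
    (idealOfThom V).mem = thickClosure fun E => ∃ 𝔭 ∈ V.carrier, residueObjects 𝔭 E := by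
  refine le_antisymm (fun E hE J hJ hV => ?_) fun E hE => ?_
  · refine hJ.prop_of_forall_primeOf fun 𝔭 h => ?_
    obtain ⟨X, hX⟩ := exists_residueObjects 𝔭
    exact ⟨X, hV X ⟨𝔭, mem_idealOfThom.1 hE 𝔭 h, hX⟩,
      fun h' => (primeOf_residue_iff hX).1 h' le_rfl⟩
  · refine hE _ (idealOfThom V).isThickTensorIdeal.toIsThick ?_
    rintro X ⟨𝔭, h𝔭, hX⟩
    exact mem_idealOfThom_of_residueObjects h𝔭 hX

/-- The lattice isomorphism between radical thick tensor-ideals and Thomason subsets. -/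
def supportIso : RadicalTensorIdeal (DPerf R) ≃o Thom (PrimeSpectrum R) where
  toFun := supportThom
  invFun := idealOfThom
  left_inv J := RadicalTensorIdeal.mem_injective <| by
    ext E
    rw [mem_idealOfThom, J.mem_iff]
    rfl
  right_inv V := Thom.carrier_injective <| by
    ext 𝔭
    rw [mem_supportThom, RadicalTensorIdeal.exists_residueObjects_iff]
    refine ⟨fun ⟨E, hE, h⟩ => mem_idealOfThom.1 hE 𝔭 h, fun h => ?_⟩
    obtain ⟨E, hE⟩ := exists_residueObjects 𝔭
    exact ⟨E, mem_idealOfThom_of_residueObjects h hE,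
      fun h' => (primeOf_residue_iff hE).1 h' le_rfl⟩
  map_rel_iff' {J J'} := by
    refine ⟨fun h E hE => J'.mem_iff.2 fun 𝔭 h𝔭 => h (J.mem_iff.1 hE 𝔭 h𝔭), ?_⟩
    rintro h 𝔭 ⟨E, hE, hJ⟩
    exact ⟨E, hE, h E hJ⟩

lemma not_mem_supportThom_iff {J : RadicalTensorIdeal (DPerf R)} {𝔭 : PrimeSpectrum R} :
    𝔭 ∉ (supportThom J).carrier ↔ J ≤ primeIdeal 𝔭 := by
  rw [mem_supportThom, RadicalTensorIdeal.exists_residueObjects_iff]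
  push Not
  rfl

/-- The point of `𝔭` is false exactly on the ideals below `P(𝔭)`, so their join is `P(𝔭)` itself. -/
lemma ideal_homeoHochsterDual (𝔭 : PrimeSpectrum R) :
    Spc.ideal (homeoHochsterDual (supportIso (R := R)) 𝔭) = primeIdeal 𝔭 := by
  refine le_antisymm (sSup_le fun J hJ => not_mem_supportThom_iff.1 hJ) (le_sSup ?_)
  exact not_mem_supportThom_iff.2 le_rfl

end OrderIso

end

theorem mainTheorem10 {k : Type u} [Field k] :
    IsCoherentFrame (Thom (PrimeSpectrum (Polynomial k))) ∧
    IsCoherentFrame (RadicalTensorIdeal (DPerf (Polynomial k))) ∧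
    (∃ (φ : RadicalTensorIdeal (DPerf (Polynomial k)) → Thom (PrimeSpectrum (Polynomial k)))
      (ψ : Thom (PrimeSpectrum (Polynomial k)) → RadicalTensorIdeal (DPerf (Polynomial k))),
      (∀ J, (φ J).carrier = {𝔭 | ∃ E, residueObjects 𝔭 E ∧ J.mem E}) ∧
      (∀ V, (ψ V).mem = thickClosure fun E => ∃ 𝔭 ∈ V.carrier, residueObjects 𝔭 E) ∧
      IsCoherentFrameHom φ ∧ IsCoherentFrameHom ψ ∧
      Function.LeftInverse φ ψ ∧ Function.RightInverse φ ψ) ∧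
    ∃ h : PrimeSpectrum (Polynomial k) ≃ₜ Spc (DPerf (Polynomial k)),
      ∀ 𝔭, IsPrimeTensorIdeal (primeOf 𝔭) ∧ (h 𝔭).ideal.mem = primeOf 𝔭 :=
  ⟨Thom.isCoherentFrame, Thom.isCoherentFrame.of_orderIso supportIso.symm,
    ⟨supportIso, supportIso.symm, fun _ => rfl, idealOfThom_mem_eq_thickClosure,
      supportIso.isCoherentFrameHom, supportIso.symm.isCoherentFrameHom,
      supportIso.apply_symm_apply, supportIso.symm_apply_apply⟩,
    homeoHochsterDual supportIso, fun 𝔭 => ⟨isPrimeTensorIdeal_primeOf 𝔭,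
      congrArg RadicalTensorIdeal.mem (ideal_homeoHochsterDual 𝔭)⟩⟩
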